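/- Let $M=\mathbb{R}^3\setminus\{i_1,\dots,i_N\}$, where the $i_n$ lie on the $z$-axis, let $\eta=\partial_\phi$ be the rotation field about this axis, and let $g$ be a smooth Riemannian metric on $M$ with $\mathfrak{L}_\eta g=0$. Let $f,\varphi$ be functions and $Y=Y_i\,dx^i$ a 1-form on $M$ with $\mathfrak{L}_\eta f=\mathfrak{L}_\eta\varphi=\mathfrak{L}_\eta Y=0$, and set $$\overline{g}_{ij}=g_{ij}+f_iY_j+f_jY_i+\varphi f_if_j,\qquad f_i=\partial_i f .$$ Assume that the vector field dual to $Y$ with respect to $\overline g$ is $Y^\phi\partial_\phi$ for a function $Y^\phi$, that $u>0$ satisfies $u^2=\varphi+|Y|^2_{\overline g}$, and that $f$, $u$, $Y^\phi$ are smooth on $M$. Put $$\overline{k}_{ij}=\frac{1}{2u}\left(\overline\nabla_iY_j+\overline\nabla_jY_i\right),\qquad \pi_{ij}=\frac{u\nabla_{ij}f+u_if_j+u_jf_i+\frac{1}{2u}\left(g_{i\phi}\partial_jY^\phi+g_{j\phi}\partial_iY^\phi\right)}{\sqrt{1+u^2|\nabla f|_g^2}},$$ where $\nabla,\overline\nabla$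 are the Levi-Civita connections of $g,\overline g$, $u_i=\partial_iu$, $g_{i\phi}=g(\partial_i,\eta)$, $g_{\phi\phi}=g(\eta,\eta)$ and $f^i=g^{ij}f_j$. Then the following equations are equivalent, both as equations on $M$ and pointwise at each point off the axis (where the last three equations are imposed): 1. $\mathrm{div}_{\overline g}\,\overline k(\eta)=0$; 2. $\Delta_{\overline g}Y^\phi+\overline\nabla\log(u^{-1}g_{\phi\phi})\cdot\overline\nabla Y^\phi=0$, the inner product being that of $\overline g$; 3. in any global Brill coordinates $(\overline\rho,\phi,\overline z)$ for $\overline g$, that is, cylindrical coordinates with $\eta=\partial_\phi$ in which $\overline g=e^{-2\overline U+2\overline\alpha}(d\overline\rho^2+d\overline z^2)+\overline\rho^2e^{-2\overline U}(d\phi+A_{\overline\rho}d\overline\rho+A_{\overline z}d\overline z)^2$ with coefficients depending only on $(\overline\rho,\overline z)$, $$\frac{e^{2\overline U-2\overline\alpha}}{2\sqrt{g_{\phi\phi}}}\sum_{p=\overline\rho,\overline z}\partial_p\left(u^{-1}g_{\phi\phi}^{3/2}\,\partial_pY^\phi\right)=0;$$ 4. $$\left(g^{ij}-\frac{u^2f^if^j}{1+u^2|\nabla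 f|_g^2}\right)\left(\nabla_{ij}Y^\phi-\frac{u\pi_{ij}f^l}{\sqrt{1+u^2|\nabla f|_g^2}}\partial_lY^\phi\right)+\left(g^{ij}-\frac{u^2f^if^j}{1+u^2|\nabla f|_g^2}\right)\left(\partial_i\log g_{\phi\phi}-\frac{\partial_i\log u}{1+u^2|\nabla f|_g^2}\right)\partial_jY^\phi=0.$$ -/

import Mathlib

open scoped ContDiff

namespace AxiData

/-- Points of `ℝ³`, with Cartesian coordinates `x 0, x 1, x 2`. -/
abbrev Pt := Fin 3 → ℝ

/-- Partial derivative `∂_i F`. -/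
noncomputable def pd (F : Pt → ℝ) (i : Fin 3) (x : Pt) : ℝ :=
  fderiv ℝ F x (Pi.single i 1)

/-- The axis of rotation (the third coordinate axis). -/
def axis : Set Pt := {x | x 0 = 0 ∧ x 1 = 0}

/-- The rotation field `η = ∂_φ` about the axis. -/
def rot (x : Pt) : Pt := ![-x 1, x 0, 0]

/-! ### Lie derivatives along a vector field `X` -/

/-- `(𝔏_X F)`. -/
noncomputable def lieFun (X : Pt → Pt) (F : Pt → ℝ) (x : Pt) : ℝ :=
  ∑ j, X x j * pd F j x

/-- `(𝔏_X β)_i`. -/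
noncomputable def lieForm (X : Pt → Pt) (β : Pt → Fin 3 → ℝ) (i : Fin 3) (x : Pt) : ℝ :=
  ∑ j, (X x j * pd (fun y => β y i) j x + β x j * pd (fun y => X y j) i x)

/-- `(𝔏_X T)_{ij}` for a tensor `T` of type `(0,2)`. -/
noncomputable def lieTensor (X : Pt → Pt) (T : Pt → Matrix (Fin 3) (Fin 3) ℝ)
    (i j : Fin 3) (x : Pt) : ℝ :=
  ∑ l, (X x l * pd (fun y => T y i j) l x + T x l j * pd (fun y => X y l) i x
    + T x i l * pd (fun y => X y l) j x)

/-! ### Riemannian calculus of a metric `G` with components `G x i j` -/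

/-- Christoffel symbols `Γ^l_{ij}`. -/
noncomputable def christoffel (G : Pt → Matrix (Fin 3) (Fin 3) ℝ) (l i j : Fin 3) (x : Pt) : ℝ :=
  (1 / 2) * ∑ m, (G x)⁻¹ l m *
    (pd (fun y => G y j m) i x + pd (fun y => G y i m) j x - pd (fun y => G y i j) m x)

/-- `∇_i β_j` for a 1-form. -/
noncomputable def covForm (G : Pt → Matrix (Fin 3) (Fin 3) ℝ) (β : Pt → Fin 3 → ℝ)
    (i j : Fin 3) (x : Pt) : ℝ :=
  pd (fun y => β y j) i x - ∑ l, christoffel G l i j x * β x l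

/-- `∇_i T_{jl}` for a tensor of type `(0,2)`. -/
noncomputable def covTensor (G T : Pt → Matrix (Fin 3) (Fin 3) ℝ) (i j l : Fin 3) (x : Pt) : ℝ :=
  pd (fun y => T y j l) i x
    - ∑ m, (christoffel G m i j x * T x m l + christoffel G m i l x * T x j m)

/-- `(div_G T)_l = G^{ij} ∇_i T_{jl}`. -/
noncomputable def divTensor (G T : Pt → Matrix (Fin 3) (Fin 3) ℝ) (l : Fin 3) (x : Pt) : ℝ :=
  ∑ i, ∑ j, (G x)⁻¹ i j * covTensor G T i j l x

/-- The Hessian `∇_{ij} F = ∂_i ∂_j F - Γ^l_{ij} ∂_l F`. -/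
noncomputable def hess (G : Pt → Matrix (Fin 3) (Fin 3) ℝ) (F : Pt → ℝ) (i j : Fin 3)
    (x : Pt) : ℝ :=
  pd (pd F j) i x - ∑ l, christoffel G l i j x * pd F l x

/-- The Laplace-Beltrami operator `Δ_G F = G^{ij} ∇_{ij} F`. -/
noncomputable def laplacian (G : Pt → Matrix (Fin 3) (Fin 3) ℝ) (F : Pt → ℝ) (x : Pt) : ℝ :=
  ∑ i, ∑ j, (G x)⁻¹ i j * hess G F i j x

/-- `∇F · ∇H = G^{ij} ∂_i F ∂_j H`. -/
noncomputable def gradDot (G : Pt → Matrix (Fin 3) (Fin 3) ℝ) (F H : Pt → ℝ) (x : Pt) : ℝ :=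
  ∑ i, ∑ j, (G x)⁻¹ i j * pd F i x * pd H j x

/-- The raised gradient `F^i = G^{ij} ∂_j F`. -/
noncomputable def gradUp (G : Pt → Matrix (Fin 3) (Fin 3) ℝ) (F : Pt → ℝ) (i : Fin 3)
    (x : Pt) : ℝ :=
  ∑ j, (G x)⁻¹ i j * pd F j x

/-- `|β|²_G = G^{ij} β_i β_j` for a 1-form. -/
noncomputable def formSq (G : Pt → Matrix (Fin 3) (Fin 3) ℝ) (β : Pt → Fin 3 → ℝ) (x : Pt) : ℝ :=
  ∑ i, ∑ j, (G x)⁻¹ i j * β x i * β x j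

/-! ### Components with index `φ`, and the deformed data -/

/-- `G_{iφ} = G(∂_i, η)`. -/
noncomputable def compPhi (G : Pt → Matrix (Fin 3) (Fin 3) ℝ) (i : Fin 3) (x : Pt) : ℝ :=
  ∑ j, G x i j * rot x j

/-- `G_{φφ} = G(η, η)`. -/
noncomputable def phiPhi (G : Pt → Matrix (Fin 3) (Fin 3) ℝ) (x : Pt) : ℝ :=
  ∑ i, ∑ j, G x i j * rot x i * rot x j

/-- `ḡ_{ij} = g_{ij} + f_i Y_j + f_j Y_i + φ f_i f_j`. -/
noncomputable def gBar (g : Pt → Matrix (Fin 3) (Fin 3) ℝ) (f : Pt → ℝ) (Y : Pt → Fin 3 → ℝ)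
    (φ : Pt → ℝ) (x : Pt) : Matrix (Fin 3) (Fin 3) ℝ :=
  Matrix.of fun i j =>
    g x i j + pd f i x * Y x j + pd f j x * Y x i + φ x * pd f i x * pd f j x

/-- `k̄_{ij} = (1 / 2u) (∇̄_i Y_j + ∇̄_j Y_i)`, with `∇̄` the Levi-Civita connection of `G = ḡ`. -/
noncomputable def kBar (G : Pt → Matrix (Fin 3) (Fin 3) ℝ) (Y : Pt → Fin 3 → ℝ) (u : Pt → ℝ)
    (x : Pt) : Matrix (Fin 3) (Fin 3) ℝ :=
  Matrix.of fun i j => 1 / (2 * u x) * (covForm G Y i j x + covForm G Y j i x)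

/-- `1 + u² |∇f|²_g`. -/
noncomputable def wFac (g : Pt → Matrix (Fin 3) (Fin 3) ℝ) (u f : Pt → ℝ) (x : Pt) : ℝ :=
  1 + u x ^ 2 * gradDot g f f x

/-- The tensor `π_{ij}`, the second fundamental form of the graph in the Lorentzian setting. -/
noncomputable def piForm (g : Pt → Matrix (Fin 3) (Fin 3) ℝ) (u f Yphi : Pt → ℝ) (i j : Fin 3)
    (x : Pt) : ℝ :=
  (u x * hess g f i j x + pd u i x * pd f j x + pd u j x * pd f i x
      + 1 / (2 * u x) * (compPhi g i x * pd Yphi j x + compPhi g j x * pd Yphi i x))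
    / Real.sqrt (wFac g u f x)

/-! ### Brill coordinates -/

/-- Components of `e^{-2U+2α}(dρ² + dz²) + ρ² e^{-2U} (dφ + A_ρ dρ + A_z dz)²` in the coordinates
`q = (ρ, φ, z)`. -/
noncomputable def brillMatrix (U α Aρ Az : ℝ → ℝ → ℝ) (q : Pt) : Matrix (Fin 3) (Fin 3) ℝ :=
  Matrix.of fun i j =>
    let E := Real.exp (-2 * U (q 0) (q 2) + 2 * α (q 0) (q 2))
    let θ : Fin 3 → ℝ := ![Aρ (q 0) (q 2), 1, Az (q 0) (q 2)]
    (if i = j ∧ i ≠ 1 then E else 0)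
      + q 0 ^ 2 * Real.exp (-2 * U (q 0) (q 2)) * θ i * θ j

/-- `Ψ : (ρ, φ, z) ↦ x`, for `ρ > 0`, is the inverse of a system of global cylindrical Brill
coordinates for the metric `G` on `M`: it parametrizes `M` minus the axis, with the angle `φ`
taken modulo `2π`, satisfies `∂_φ = η`, and pulls `G` back to Brill form with coefficients
`U, α, A_ρ, A_z` that depend only on `(ρ, z)`. -/
structure IsBrill (M : Set Pt) (G : Pt → Matrix (Fin 3) (Fin 3) ℝ) (Ψ : Pt → Pt)
    (U α Aρ Az : ℝ → ℝ → ℝ) : Prop where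
  smooth : ContDiffOn ℝ ∞ Ψ {q | 0 < q 0}
  smooth_U : ContDiffOn ℝ ∞ (Function.uncurry U) {s | 0 < s.1}
  smooth_α : ContDiffOn ℝ ∞ (Function.uncurry α) {s | 0 < s.1}
  smooth_Aρ : ContDiffOn ℝ ∞ (Function.uncurry Aρ) {s | 0 < s.1}
  smooth_Az : ContDiffOn ℝ ∞ (Function.uncurry Az) {s | 0 < s.1}
  image : Ψ '' {q | 0 < q 0} = M \ axis
  inj : ∀ q q' : Pt, 0 < q 0 → 0 < q' 0 →
    (Ψ q = Ψ q' ↔ q 0 = q' 0 ∧ q 2 = q' 2 ∧ ∃ n : ℤ, q' 1 = q 1 + 2 * Real.pi * n)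
  dphi : ∀ q : Pt, 0 < q 0 → ∀ a, pd (fun y => Ψ y a) 1 q = rot (Ψ q) a
  metric : ∀ q : Pt, 0 < q 0 → ∀ i j,
    ∑ a, ∑ b, G (Ψ q) a b * pd (fun y => Ψ y a) i q * pd (fun y => Ψ y b) j q
      = brillMatrix U α Aρ Az q i j

/-! ### The four equations, as equations on a subset `Ω` of `M`

The last three contain `log g_{φφ}` or are written in cylindrical coordinates and are therefore
imposed off the axis. -/

/-- `div_ḡ k̄ (η) = 0` on `Ω`, with `G = ḡ`. -/
def DivEq (G : Pt → Matrix (Fin 3) (Fin 3) ℝ) (Y : Pt → Fin 3 → ℝ) (u : Pt → ℝ)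
    (Ω : Set Pt) : Prop :=
  ∀ x ∈ Ω, ∑ l, divTensor G (kBar G Y u) l x * rot x l = 0

/-- `Δ_ḡ Y^φ + ∇̄ log (u⁻¹ g_{φφ}) · ∇̄ Y^φ = 0` on `Ω` off the axis, with `G = ḡ`. -/
def LaplaceEq (G g : Pt → Matrix (Fin 3) (Fin 3) ℝ) (u Yphi : Pt → ℝ) (Ω : Set Pt) : Prop :=
  ∀ x ∈ Ω \ axis,
    laplacian G Yphi x + gradDot G (fun y => Real.log ((u y)⁻¹ * phiPhi g y)) Yphi x = 0

/-- `e^{2U-2α} / (2 √g_{φφ}) ∑_{p = ρ, z} ∂_p (u⁻¹ g_{φφ}^{3/2} ∂_p Y^φ) = 0` in the coordinates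
`(ρ, φ, z)`, at the points that correspond to points of `Ω`. -/
def BrillEq (g : Pt → Matrix (Fin 3) (Fin 3) ℝ) (u Yphi : Pt → ℝ) (Ψ : Pt → Pt)
    (U α : ℝ → ℝ → ℝ) (Ω : Set Pt) : Prop :=
  ∀ q : Pt, 0 < q 0 → Ψ q ∈ Ω →
    Real.exp (2 * U (q 0) (q 2) - 2 * α (q 0) (q 2)) / (2 * Real.sqrt (phiPhi g (Ψ q))) *
      ∑ p ∈ ({0, 2} : Finset (Fin 3)),
        pd (fun s => (u (Ψ s))⁻¹ * phiPhi g (Ψ s) ^ (3 / 2 : ℝ)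
          * pd (fun t => Yphi (Ψ t)) p s) p q = 0

/-- The equation written with respect to `g`:
`(g^{ij} - u² f^i f^j / W) (∇_{ij} Y^φ - u π_{ij} f^l ∂_l Y^φ / √W)
  + (g^{ij} - u² f^i f^j / W) (∂_i log g_{φφ} - ∂_i log u / W) ∂_j Y^φ = 0`
on `Ω` off the axis, where `W = 1 + u² |∇f|²_g`. -/
def EllipticEq (g : Pt → Matrix (Fin 3) (Fin 3) ℝ) (u f Yphi : Pt → ℝ) (Ω : Set Pt) : Prop :=
  ∀ x ∈ Ω \ axis,
    (∑ i, ∑ j,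
      ((g x)⁻¹ i j - u x ^ 2 * gradUp g f i x * gradUp g f j x / wFac g u f x)
        * (hess g Yphi i j x
          - ∑ l, u x * piForm g u f Yphi i j x * gradUp g f l x / Real.sqrt (wFac g u f x)
              * pd Yphi l x))
    + (∑ i, ∑ j,
      ((g x)⁻¹ i j - u x ^ 2 * gradUp g f i x * gradUp g f j x / wFac g u f x)
        * (pd (fun y => Real.log (phiPhi g y)) i x
          - pd (fun y => Real.log (u y)) i x / wFac g u f x)
        * pd Yphi j x) = 0

end AxiData

open AxiData

/-!
Write `h = |η|²`, `a = Y^φ`, and let `c = h / (2u)`. All four equations say that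
`c Δ_ḡ a + ∇̄c · ∇̄a = 0`.

Contracting `Y = a ḡ(η, ·)` with `η` shows that `ḡ` is the metric
`g + a (df ⊗ η♭ + η♭ ⊗ df) + (u² + a² h) df ⊗ df`, here `deformed g u f a`
(`gBar_eq_deformed`). In particular `ḡ` is nondegenerate, `η` is a Killing field of it, and
`ḡ(η, η) = h`; the functions `a` and `u` inherit their invariance from `Y` and `φ`.

* Since `η` is a Killing field, `2u k̄ = L_{aη} ḡ = da ⊗ ḡ(η, ·) + ḡ(η, ·) ⊗ da`, and `div k̄ (η)`
  is the divergence of the 1-form `k̄(η) = c da` (`KillingAt.divTensor_kBar`). Dividing by `c`, which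
  is nonzero off the axis, gives the equation with `log (u⁻¹ h)` (`weighted_laplacian_eq`).
* The Laplacian and the inner product of gradients do not depend on coordinates
  (`PullbackAt.laplacian_eq`, `PullbackAt.gradDot_eq`). In Brill form the metric is
  `E (dρ² + dz²) + h (dφ + A dρ + B dz)²`, with `√det = E √h`, so on functions of `(ρ, z)` the
  operator is `(2 E √h)⁻¹ ∑ ∂_p (u⁻¹ h^{3/2} ∂_p a)` (`IsBrill.expression_eq`).
* The inverse of `ḡ` is explicit (`deformedInv`), and so are the differences of the Christoffel
  symbols of `ḡ` and `g`. They involve the derivatives of `f`, `a`, `u`, `h` and the antisymmetric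
  tensor `∇_i η_j`. In the trace of the Hessian of `a` the terms containing `∇η`, `∇h` and `a` itself
  cancel, because `∇_{ij} F η^j = -∇_i η_j F^j` for invariant `F`
  (`KillingAt.hess_rot`, `DataAt.laplacian_deformed`). The remaining terms combine into the
  left-hand side of the last equation, without any factor (`DataAt.laplacian_add_eq_elliptic`).
-/

namespace AxiData

open Filter Topology

/-! ### Partial derivatives -/

section PartialDerivatives

variable {F H : Pt → ℝ} {x : Pt}

theorem pd_congr (h : F =ᶠ[𝓝 x] H) (i : Fin 3) : pd F i x = pd H i x := by
  simp only [pd, h.fderiv_eq]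

theorem pd_add (hF : ContDiffAt ℝ ∞ F x) (hH : ContDiffAt ℝ ∞ H x) (i : Fin 3) :
    pd (fun y => F y + H y) i x = pd F i x + pd H i x := by
  have h1 := hF.differentiableAt (by simp)
  have h2 := hH.differentiableAt (by simp)
  simp only [pd]
  rw [show (fun y => F y + H y) = F + H from rfl, fderiv_add h1 h2]
  rfl

theorem pd_mul (hF : ContDiffAt ℝ ∞ F x) (hH : ContDiffAt ℝ ∞ H x) (i : Fin 3) :
    pd (fun y => F y * H y) i x = F x * pd H i x + H x * pd F i x := by
  have h1 := hF.differentiableAt (by simp)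
  have h2 := hH.differentiableAt (by simp)
  simp only [pd]
  rw [show (fun y => F y * H y) = F * H from rfl, fderiv_mul h1 h2]
  simp

theorem pd_sum {F : Fin 3 → Pt → ℝ} (hF : ∀ j, ContDiffAt ℝ ∞ (F j) x) (i : Fin 3) :
    pd (fun y => ∑ j, F j y) i x = ∑ j, pd (F j) i x := by
  have h1 := fun j => (hF j).differentiableAt (by simp)
  simp only [pd]
  rw [fderiv_fun_sum (fun j _ => h1 j)]
  simp

theorem pd_const (c : ℝ) (i : Fin 3) : pd (fun _ => c) i x = 0 := by
  simp [pd]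

theorem contDiffAt_pd (hF : ContDiffAt ℝ ∞ F x) (i : Fin 3) : ContDiffAt ℝ ∞ (pd F i) x :=
  (hF.fderiv_right (m := ∞) (by simp)).clm_apply contDiffAt_const

theorem pd_comm (hF : ContDiffAt ℝ ∞ F x) (i j : Fin 3) :
    pd (pd F i) j x = pd (pd F j) i x := by
  have two_le : (2 : WithTop ℕ∞) ≤ ∞ := WithTop.coe_le_coe.2 le_top
  have h := (hF.isSymmSndFDerivAt (by simpa using two_le)).eq (Pi.single j 1) (Pi.single i 1)
  have h1 : DifferentiableAt ℝ (fderiv ℝ F) x :=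
    (hF.fderiv_right (m := ∞) (by simp)).differentiableAt (by simp)
  have key : ∀ k l : Fin 3, pd (pd F k) l x
      = fderiv ℝ (fderiv ℝ F) x (Pi.single l 1) (Pi.single k 1) := by
    intro k l
    change fderiv ℝ (fun y => fderiv ℝ F y (Pi.single k 1)) x (Pi.single l 1) = _
    rw [fderiv_clm_apply h1 (differentiableAt_const _)]
    simp
  rw [key, key, h]

theorem pd_log (hF : ContDiffAt ℝ ∞ F x) (h0 : F x ≠ 0) (i : Fin 3) :
    pd (fun y => Real.log (F y)) i x = pd F i x / F x := by
  simp only [pd]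
  rw [fderiv.log (hF.differentiableAt (by simp)) h0]
  simp [div_eq_inv_mul]

theorem pd_comp {Ψ : Pt → Pt} {q : Pt} (h1 : DifferentiableAt ℝ F (Ψ q))
    (h2 : DifferentiableAt ℝ Ψ q) (p : Fin 3) :
    pd (fun s => F (Ψ s)) p q = ∑ a, pd F a (Ψ q) * pd (fun s => Ψ s a) p q := by
  have h3 : ∀ a, pd (fun s => Ψ s a) p q = fderiv ℝ Ψ q (Pi.single p 1) a := by
    intro a
    simp only [pd]
    have := (hasFDerivAt_pi'.1 h2.hasFDerivAt a).fderiv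
    rw [this]; rfl
  simp only [h3]
  simp only [pd]
  rw [show (fun s => F (Ψ s)) = F ∘ Ψ from rfl, fderiv_comp q h1 h2]
  simp only [ContinuousLinearMap.comp_apply]
  conv_lhs => rw [pi_eq_sum_univ' (fderiv ℝ Ψ q (Pi.single p 1))]
  rw [map_sum]
  refine Finset.sum_congr rfl fun a _ => ?_
  rw [map_smul, smul_eq_mul, mul_comm]

theorem contDiff_rot (j : Fin 3) : ContDiff ℝ ∞ (fun y : Pt => rot y j) := by
  fin_cases j <;> simp [rot] <;> fun_prop

end PartialDerivatives

/-! ### Metrics with Killing field `η`, and invariant functions -/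

/-- Christoffel symbols of the first kind, `G_{ml} Γ^l_{ij}`. -/
noncomputable def chrLow (G : Pt → Matrix (Fin 3) (Fin 3) ℝ) (m i j : Fin 3) (x : Pt) : ℝ :=
  1 / 2 * (pd (fun y => G y j m) i x + pd (fun y => G y i m) j x - pd (fun y => G y i j) m x)

/-- `G` is, near `x`, a smooth symmetric tensor, nondegenerate at `x`. -/
structure MetricAt (G : Pt → Matrix (Fin 3) (Fin 3) ℝ) (x : Pt) : Prop where
  smooth : ∀ i j, ContDiffAt ℝ ∞ (fun y => G y i j) x
  symm : ∀ᶠ y in 𝓝 x, ∀ i j, G y i j = G y j i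
  det_ne : (G x).det ≠ 0

/-- `F` is, near `x`, a smooth function invariant under the rotation. -/
structure InvariantAt (F : Pt → ℝ) (x : Pt) : Prop where
  smooth : ContDiffAt ℝ ∞ F x
  inv : ∀ᶠ y in 𝓝 x, lieFun rot F y = 0

namespace MetricAt

variable {G : Pt → Matrix (Fin 3) (Fin 3) ℝ} {x : Pt}

theorem symm_self (h : MetricAt G x) (i j : Fin 3) : G x i j = G x j i :=
  h.symm.self_of_nhds i j

theorem pd_symm (h : MetricAt G x) (i j k : Fin 3) :
    pd (fun y => G y i j) k x = pd (fun y => G y j i) k x :=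
  pd_congr (h.symm.mono fun _ hy => hy i j) k

theorem inv_symm (h : MetricAt G x) (i j : Fin 3) : (G x)⁻¹ i j = (G x)⁻¹ j i := by
  have h1 : (G x).transpose = G x := by
    ext i j; exact h.symm_self j i
  have h2 : ((G x)⁻¹).transpose = (G x)⁻¹ := by rw [Matrix.transpose_nonsing_inv, h1]
  exact (congrFun (congrFun h2 j) i)

theorem inv_mul (h : MetricAt G x) : (G x)⁻¹ * G x = 1 :=
  Matrix.nonsing_inv_mul _ (isUnit_iff_ne_zero.2 h.det_ne)

theorem mul_inv (h : MetricAt G x) : G x * (G x)⁻¹ = 1 :=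
  Matrix.mul_nonsing_inv _ (isUnit_iff_ne_zero.2 h.det_ne)

theorem lower_gradUp (h : MetricAt G x) (F : Pt → ℝ) (i : Fin 3) :
    ∑ j, G x i j * gradUp G F j x = pd F i x := by
  have : (G x).mulVec (fun j => gradUp G F j x) = fun i => pd F i x := by
    change (G x).mulVec ((G x)⁻¹.mulVec fun i => pd F i x) = _
    rw [Matrix.mulVec_mulVec, h.mul_inv, Matrix.one_mulVec]
  exact congrFun this i

theorem raise_compPhi (h : MetricAt G x) (i : Fin 3) :
    ∑ j, (G x)⁻¹ i j * compPhi G j x = rot x i := by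
  have : (G x)⁻¹.mulVec ((G x).mulVec (rot x)) = rot x := by
    rw [Matrix.mulVec_mulVec, h.inv_mul, Matrix.one_mulVec]
  exact congrFun this i

theorem sum_christoffel_mul (h : MetricAt G x) (β : Fin 3 → ℝ) (i j : Fin 3) :
    ∑ l, christoffel G l i j x * β l
      = ∑ m, (∑ l, (G x)⁻¹ m l * β l) * chrLow G m i j x := by
  simp only [christoffel, chrLow, Fin.sum_univ_three]
  rw [h.inv_symm 1 0, h.inv_symm 2 0, h.inv_symm 2 1]
  ring

theorem hess_eq (h : MetricAt G x) (F : Pt → ℝ) (i j : Fin 3) :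
    hess G F i j x = pd (pd F j) i x - ∑ m, gradUp G F m x * chrLow G m i j x := by
  rw [hess, h.sum_christoffel_mul (fun l => pd F l x)]
  rfl

theorem chrLow_symm (h : MetricAt G x) (m i j : Fin 3) :
    chrLow G m i j x = chrLow G m j i x := by
  rw [chrLow, chrLow, h.pd_symm i j]; ring

theorem hess_symm (h : MetricAt G x) {F : Pt → ℝ} (hF : ContDiffAt ℝ ∞ F x) (i j : Fin 3) :
    hess G F i j x = hess G F j i x := by
  rw [h.hess_eq, h.hess_eq, pd_comm hF]
  simp only [h.chrLow_symm _ i j]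

theorem pd_compPhi (h : MetricAt G x) (i k : Fin 3) :
    pd (compPhi G i) k x
      = ∑ j, (pd (fun y => G y i j) k x * rot x j + G x i j * pd (fun y => rot y j) k x) := by
  change pd (fun y => ∑ j, G y i j * rot y j) k x = _
  rw [pd_sum fun j => (h.smooth i j).mul (contDiff_rot j).contDiffAt]
  refine Finset.sum_congr rfl fun j _ => ?_
  rw [pd_mul (h.smooth i j) (contDiff_rot j).contDiffAt]
  ring

theorem contDiffAt_compPhi (h : MetricAt G x) (i : Fin 3) : ContDiffAt ℝ ∞ (compPhi G i) x := by
  change ContDiffAt ℝ ∞ (fun y => ∑ j, G y i j * rot y j) x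
  exact ContDiffAt.sum fun j _ => (h.smooth i j).mul (contDiff_rot j).contDiffAt

theorem phiPhi_eq (G : Pt → Matrix (Fin 3) (Fin 3) ℝ) (x : Pt) :
    phiPhi G x = ∑ i, compPhi G i x * rot x i := by
  simp only [phiPhi, compPhi, Fin.sum_univ_three]; ring

theorem contDiffAt_phiPhi (h : MetricAt G x) : ContDiffAt ℝ ∞ (phiPhi G) x := by
  rw [show phiPhi G = fun y => ∑ i, compPhi G i y * rot y i from funext (phiPhi_eq G)]
  exact ContDiffAt.sum fun j _ => (h.contDiffAt_compPhi j).mul (contDiff_rot j).contDiffAt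

theorem pd_phiPhi (h : MetricAt G x) (k : Fin 3) :
    pd (phiPhi G) k x = ∑ i, (pd (compPhi G i) k x * rot x i
      + compPhi G i x * pd (fun y => rot y i) k x) := by
  rw [show phiPhi G = fun y => ∑ i, compPhi G i y * rot y i from funext (phiPhi_eq G)]
  rw [pd_sum fun j => (h.contDiffAt_compPhi j).mul (contDiff_rot j).contDiffAt]
  refine Finset.sum_congr rfl fun j _ => ?_
  rw [pd_mul (h.contDiffAt_compPhi j) (contDiff_rot j).contDiffAt]
  ring

end MetricAt

/-- The covariant derivative `∇_i η_m` of the Killing form, which is half its exterior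
derivative. -/
noncomputable def covEta (G : Pt → Matrix (Fin 3) (Fin 3) ℝ) (i m : Fin 3) (x : Pt) : ℝ :=
  1 / 2 * (pd (compPhi G m) i x - pd (compPhi G i) m x)

theorem covEta_antisymm (G : Pt → Matrix (Fin 3) (Fin 3) ℝ) (i m : Fin 3) (x : Pt) :
    covEta G i m x = -covEta G m i x := by
  rw [covEta, covEta]; ring

namespace InvariantAt

variable {F : Pt → ℝ} {x : Pt}

theorem sum_rot (hF : InvariantAt F x) : ∑ j, rot x j * pd F j x = 0 := hF.inv.self_of_nhds

/-- The derivative of the identity `η^j ∂_j F = 0`. -/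
theorem sum_rot_pd (hF : InvariantAt F x) (i : Fin 3) :
    ∑ j, rot x j * pd (pd F j) i x = -∑ j, pd F j x * pd (fun y => rot y j) i x := by
  have h1 : pd (lieFun rot F) i x = 0 := by
    rw [pd_congr (H := fun _ => 0) hF.inv, pd_const]
  have h2 : pd (lieFun rot F) i x
      = ∑ j, (rot x j * pd (pd F j) i x + pd F j x * pd (fun y => rot y j) i x) := by
    change pd (fun y => ∑ j, rot y j * pd F j y) i x = _
    rw [pd_sum fun j => (contDiff_rot j).contDiffAt.mul (contDiffAt_pd hF.smooth j)]
    exact Finset.sum_congr rfl fun j _ =>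
      pd_mul (contDiff_rot j).contDiffAt (contDiffAt_pd hF.smooth j) i
  rw [h1, Finset.sum_add_distrib] at h2
  linarith

end InvariantAt

/-- `G` is, near `x`, a smooth nondegenerate symmetric tensor for which `η` is a Killing field
at `x`. -/
structure KillingAt (G : Pt → Matrix (Fin 3) (Fin 3) ℝ) (x : Pt) : Prop extends MetricAt G x where
  lie : ∀ i j, lieTensor rot G i j x = 0

namespace KillingAt

variable {G : Pt → Matrix (Fin 3) (Fin 3) ℝ} {x : Pt}

/-- The Killing equation `∂_i η_j + ∂_j η_i = 2 Γ^m_{ij} η_m`. -/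
theorem pd_compPhi_add (h : KillingAt G x) (i j : Fin 3) :
    pd (compPhi G j) i x + pd (compPhi G i) j x = 2 * ∑ m, rot x m * chrLow G m i j x := by
  have hl := h.lie i j
  simp only [lieTensor, h.pd_compPhi, chrLow, Fin.sum_univ_three] at hl ⊢
  rw [h.symm_self 0 j, h.symm_self 1 j, h.symm_self 2 j] at hl
  linear_combination hl

/-- `η^j Γ_{m,ij} = ∇_i η_m - G_{ml} ∂_i η^l`. -/
theorem sum_rot_chrLow (h : KillingAt G x) (m i : Fin 3) :
    ∑ j, rot x j * chrLow G m i j x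
      = covEta G i m x - ∑ l, G x m l * pd (fun y => rot y l) i x := by
  have hl := h.lie i m
  simp only [lieTensor, covEta, h.pd_compPhi, chrLow, Fin.sum_univ_three] at hl ⊢
  rw [h.symm_self 0 m, h.symm_self 1 m, h.symm_self 2 m] at hl
  rw [h.pd_symm 0 m, h.pd_symm 1 m, h.pd_symm 2 m]
  linear_combination 1 / 2 * hl

/-- `η^i ∇_i η_l = -½ ∂_l |η|²`. -/
theorem sum_rot_covEta (h : KillingAt G x) (l : Fin 3) :
    ∑ i, rot x i * covEta G i l x = -(1 / 2) * pd (phiPhi G) l x := by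
  have hl := fun j => h.lie l j
  have e0 := hl 0
  have e1 := hl 1
  have e2 := hl 2
  simp only [lieTensor, covEta, h.pd_phiPhi, h.pd_compPhi, compPhi, Fin.sum_univ_three]
    at e0 e1 e2 ⊢
  have s1 := h.symm_self 1 0
  have s2 := h.symm_self 2 0
  have s3 := h.symm_self 2 1
  rw [s1, s2] at e0
  rw [s3] at e1
  simp only [s1, s2, s3]
  linear_combination 1 / 2 * rot x 0 * e0 + 1 / 2 * rot x 1 * e1 + 1 / 2 * rot x 2 * e2

/-- `η^j ∇_{ij} F = -F^m ∇_i η_m`, from differentiating `η^j ∂_j F = 0`. -/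
theorem hess_rot (h : KillingAt G x) {F : Pt → ℝ} (hF : InvariantAt F x) (i : Fin 3) :
    ∑ j, rot x j * hess G F i j x = -∑ m, covEta G i m x * gradUp G F m x := by
  have e := hF.sum_rot_pd i
  have c := fun m => h.sum_rot_chrLow m i
  have g0 := h.lower_gradUp F
  simp only [h.hess_eq]
  have c0 := c 0; have c1 := c 1; have c2 := c 2
  have k0 := g0 0; have k1 := g0 1; have k2 := g0 2
  simp only [Fin.sum_univ_three] at *
  rw [h.symm_self 1 0] at k1
  rw [h.symm_self 2 0, h.symm_self 2 1] at k2
  rw [h.symm_self 1 0] at c1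
  rw [h.symm_self 2 0, h.symm_self 2 1] at c2
  linear_combination e - gradUp G F 0 x * c0 - gradUp G F 1 x * c1 - gradUp G F 2 x * c2
    + pd (fun y => rot y 0) i x * k0 + pd (fun y => rot y 1) i x * k1
    + pd (fun y => rot y 2) i x * k2

theorem phiPhi_inv (h : KillingAt G x) : lieFun rot (phiPhi G) x = 0 := by
  have e := h.sum_rot_covEta
  have e0 := e 0; have e1 := e 1; have e2 := e 2
  simp only [lieFun, Fin.sum_univ_three, covEta] at *
  linear_combination 2 * rot x 0 * e0 + 2 * rot x 1 * e1 + 2 * rot x 2 * e2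

end KillingAt

/-! ### The divergence of `k̄` -/

namespace KillingAt

variable {G : Pt → Matrix (Fin 3) (Fin 3) ℝ} {x : Pt}

/-- `∇_i η^m = G^{mk} ∇_i η_k`. -/
theorem covDeriv_rot (h : KillingAt G x) (i m : Fin 3) :
    pd (fun y => rot y m) i x + ∑ l, christoffel G m i l x * rot x l
      = ∑ k, (G x)⁻¹ m k * covEta G i k x := by
  have h1 : ∑ l, christoffel G m i l x * rot x l
      = ∑ k, (G x)⁻¹ m k * ∑ l, rot x l * chrLow G k i l x := by
    simp only [christoffel, chrLow, Fin.sum_univ_three]; ring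
  have h2 : ∑ k, (G x)⁻¹ m k * ∑ l, G x k l * pd (fun y => rot y l) i x
      = pd (fun y => rot y m) i x := by
    have : (G x)⁻¹.mulVec ((G x).mulVec fun l => pd (fun y => rot y l) i x)
        = fun l => pd (fun y => rot y l) i x := by
      rw [Matrix.mulVec_mulVec, h.inv_mul, Matrix.one_mulVec]
    exact congrFun this m
  have h3 : ∀ k, ∑ l, rot x l * chrLow G k i l x
      = covEta G i k x - ∑ l, G x k l * pd (fun y => rot y l) i x :=
    fun k => h.sum_rot_chrLow k i
  rw [h1]
  simp only [h3, mul_sub, Finset.sum_sub_distrib, h2]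
  ring

/-- A symmetric tensor contracted with the antisymmetric tensor `∇η` vanishes. -/
theorem sum_symm_covEta (h : KillingAt G x) {S : Matrix (Fin 3) (Fin 3) ℝ}
    (hS : ∀ j l, S j l = S l j) :
    ∑ i, ∑ j, (G x)⁻¹ i j * ∑ m, S j m * ∑ k, (G x)⁻¹ m k * covEta G i k x = 0 := by
  have h1 := covEta_antisymm G 1 0 x
  have h2 := covEta_antisymm G 2 0 x
  have h3 := covEta_antisymm G 2 1 x
  have d : ∀ i, covEta G i i x = 0 := fun i => by rw [covEta]; ring
  simp only [Fin.sum_univ_three, h1, h2, h3, d, hS 1 0, hS 2 0, hS 2 1,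
    h.inv_symm 1 0, h.inv_symm 2 0, h.inv_symm 2 1]
  ring

/-- As `η` is a Killing field, `div T (η) = div (T(η))` for a symmetric tensor `T`. -/
theorem divTensor_rot (h : KillingAt G x) {T : Pt → Matrix (Fin 3) (Fin 3) ℝ}
    (hT : ∀ i j, ContDiffAt ℝ ∞ (fun y => T y i j) x) (hS : ∀ i j, T x i j = T x j i) :
    ∑ l, divTensor G T l x * rot x l
      = ∑ i, ∑ j, (G x)⁻¹ i j * covForm G (fun y j => ∑ l, T y j l * rot y l) i j x := by
  have h1 : ∀ i j, ∑ l, covTensor G T i j l x * rot x l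
      = covForm G (fun y j => ∑ l, T y j l * rot y l) i j x
        - ∑ m, T x j m * ∑ k, (G x)⁻¹ m k * covEta G i k x := by
    intro i j
    have e : pd (fun y => ∑ l, T y j l * rot y l) i x
        = ∑ l, (T x j l * pd (fun y => rot y l) i x + rot x l * pd (fun y => T y j l) i x) := by
      rw [pd_sum fun l => (hT j l).mul (contDiff_rot l).contDiffAt]
      exact Finset.sum_congr rfl fun l _ => pd_mul (hT j l) (contDiff_rot l).contDiffAt i
    simp only [← h.covDeriv_rot, covForm, e]
    simp only [covTensor, Fin.sum_univ_three]
    ring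
  have h2 := h.sum_symm_covEta hS
  have h3 : ∑ l, divTensor G T l x * rot x l
      = ∑ i, ∑ j, (G x)⁻¹ i j * ∑ l, covTensor G T i j l x * rot x l := by
    simp only [divTensor, Fin.sum_univ_three]; ring
  rw [h3]
  simp only [h1, mul_sub, Finset.sum_sub_distrib, h2, sub_zero]

/-- `L_{aη} G = da ⊗ η + η ⊗ da`. -/
theorem kBar_eq (h : KillingAt G x) {a : Pt → ℝ} (ha : ContDiffAt ℝ ∞ a x)
    {Y : Pt → Fin 3 → ℝ} (hY : ∀ᶠ y in 𝓝 x, ∀ i, Y y i = a y * compPhi G i y) (u : Pt → ℝ)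
    (i j : Fin 3) :
    kBar G Y u x i j
      = 1 / (2 * u x) * (pd a i x * compPhi G j x + pd a j x * compPhi G i x) := by
  have e : ∀ i j, pd (fun y => Y y j) i x
      = a x * pd (compPhi G j) i x + compPhi G j x * pd a i x := by
    intro i j
    rw [pd_congr (H := fun y => a y * compPhi G j y) (hY.mono fun y hy => hy j),
      pd_mul ha (h.contDiffAt_compPhi j)]
  have k : ∀ i j, ∑ l, christoffel G l i j x * Y x l
      = a x * ∑ m, rot x m * chrLow G m i j x := by
    intro i j
    rw [h.sum_christoffel_mul (Y x), Finset.mul_sum]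
    refine Finset.sum_congr rfl fun m _ => ?_
    rw [← h.raise_compPhi m]
    simp only [hY.self_of_nhds, Fin.sum_univ_three]
    ring
  have s : ∑ m, rot x m * chrLow G m j i x = ∑ m, rot x m * chrLow G m i j x :=
    Finset.sum_congr rfl fun m _ => by rw [h.chrLow_symm]
  simp only [kBar, Matrix.of_apply, covForm, e, k, s]
  linear_combination 1 / (2 * u x) * a x * h.pd_compPhi_add i j

/-- `div k (η) = ½ div (u⁻¹ |η|² ∇a)`. -/
theorem divTensor_kBar (hG : ∀ᶠ y in 𝓝 x, KillingAt G y) {a : Pt → ℝ}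
    (ha : ∀ᶠ y in 𝓝 x, InvariantAt a y) {Y : Pt → Fin 3 → ℝ}
    (hY : ∀ᶠ y in 𝓝 x, ∀ i, Y y i = a y * compPhi G i y)
    {u : Pt → ℝ} (hu : ContDiffAt ℝ ∞ u x) (hu0 : u x ≠ 0) :
    ∑ l, divTensor G (kBar G Y u) l x * rot x l
      = (phiPhi G x * (1 / (2 * u x))) * laplacian G a x
        + gradDot G (fun y => phiPhi G y * (1 / (2 * u y))) a x := by
  have h := hG.self_of_nhds
  have hax := ha.self_of_nhds
  have hc : ContDiffAt ℝ ∞ (fun y => 1 / (2 * u y)) x :=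
    contDiffAt_const.div (contDiffAt_const.mul hu) (by simpa using hu0)
  have hcc : ContDiffAt ℝ ∞ (fun y => phiPhi G y * (1 / (2 * u y))) x := h.contDiffAt_phiPhi.mul hc
  have hk : ∀ᶠ y in 𝓝 x, ∀ i j, kBar G Y u y i j
      = 1 / (2 * u y) * (pd a i y * compPhi G j y + pd a j y * compPhi G i y) := by
    filter_upwards [hG, ha, hY.eventually_nhds] with y h1 h2 h3 i j
    exact h1.kBar_eq h2.smooth h3 u i j
  have hT : ∀ i j, ContDiffAt ℝ ∞ (fun y => kBar G Y u y i j) x := by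
    intro i j
    have : ContDiffAt ℝ ∞ (fun y => 1 / (2 * u y) *
        (pd a i y * compPhi G j y + pd a j y * compPhi G i y)) x :=
      hc.mul (((contDiffAt_pd hax.smooth i).mul (h.contDiffAt_compPhi j)).add
        ((contDiffAt_pd hax.smooth j).mul (h.contDiffAt_compPhi i)))
    exact this.congr_of_eventuallyEq (hk.mono fun y hy => hy i j)
  have hS : ∀ i j, kBar G Y u x i j = kBar G Y u x j i := by
    intro i j
    rw [hk.self_of_nhds i j, hk.self_of_nhds j i]; ring
  have hw : ∀ᶠ y in 𝓝 x, ∀ j, ∑ l, kBar G Y u y j l * rot y l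
      = phiPhi G y * (1 / (2 * u y)) * pd a j y := by
    filter_upwards [hk, ha] with y h1 h2 j
    have h3 := h2.sum_rot
    simp only [h1, MetricAt.phiPhi_eq, Fin.sum_univ_three] at h3 ⊢
    linear_combination 1 / (2 * u y) * compPhi G j y * h3
  rw [h.divTensor_rot hT hS]
  have hcov : ∀ i j, covForm G (fun y j => ∑ l, kBar G Y u y j l * rot y l) i j x
      = phiPhi G x * (1 / (2 * u x)) * hess G a i j x
        + pd (fun y => phiPhi G y * (1 / (2 * u y))) i x * pd a j x := by
    intro i j
    rw [covForm, pd_congr (H := fun y => phiPhi G y * (1 / (2 * u y)) * pd a j y)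
      (hw.mono fun y hy => hy j), pd_mul hcc (contDiffAt_pd hax.smooth j)]
    simp only [hw.self_of_nhds, hess, Fin.sum_univ_three]
    ring
  simp only [hcov]
  simp only [laplacian, gradDot, Fin.sum_univ_three]
  ring

end KillingAt

theorem gradDot_const_mul {G : Pt → Matrix (Fin 3) (Fin 3) ℝ} {x : Pt} {F H K : Pt → ℝ} {c : ℝ}
    (h : ∀ i, pd F i x = c * pd H i x) : gradDot G F K x = c * gradDot G H K x := by
  simp only [gradDot, h, Fin.sum_univ_three]; ring

theorem pd_log_inv_mul {u h : Pt → ℝ} {x : Pt} (hu : ContDiffAt ℝ ∞ u x) (hu0 : u x ≠ 0)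
    (hh : ContDiffAt ℝ ∞ h x) (hh0 : h x ≠ 0) (i : Fin 3) :
    pd (fun y => Real.log ((u y)⁻¹ * h y)) i x = pd h i x / h x - pd u i x / u x := by
  have hui : ContDiffAt ℝ ∞ (fun y => (u y)⁻¹) x := hu.inv hu0
  have hc := hui.mul hh
  have e : h =ᶠ[𝓝 x] fun y => u y * ((u y)⁻¹ * h y) := by
    filter_upwards [hu.continuousAt.eventually_ne hu0] with y hy
    field_simp
  have e1 := pd_congr e i
  rw [pd_mul hu hc] at e1
  rw [pd_log hc (mul_ne_zero (inv_ne_zero hu0) hh0), e1]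
  field_simp
  ring

/-- The derivative of the weight `h / (2u)`. -/
theorem pd_weight {u h : Pt → ℝ} {x : Pt} (hu : ContDiffAt ℝ ∞ u x) (hu0 : u x ≠ 0)
    (hh : ContDiffAt ℝ ∞ h x) (hh0 : h x ≠ 0) (i : Fin 3) :
    pd (fun y => h y * (1 / (2 * u y))) i x
      = (h x * (1 / (2 * u x))) * (pd h i x / h x - pd u i x / u x) := by
  have hui : ContDiffAt ℝ ∞ (fun y => (u y)⁻¹) x := hu.inv hu0
  rw [← pd_log_inv_mul hu hu0 hh hh0, pd_log (hui.mul hh) (mul_ne_zero (inv_ne_zero hu0) hh0)]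
  have : (fun y => h y * (1 / (2 * u y))) = fun y => 1 / 2 * ((u y)⁻¹ * h y) := by
    funext y; rw [one_div, mul_inv]; ring
  rw [this, pd_mul contDiffAt_const (hui.mul hh), pd_const]
  field_simp
  ring

/-- `Δa + ∇ log (u⁻¹ |η|²) · ∇a = c⁻¹ (c Δa + ∇c · ∇a)` with `c = |η|² / (2u)`. -/
theorem weighted_laplacian_eq {G : Pt → Matrix (Fin 3) (Fin 3) ℝ} {x : Pt} {a u h : Pt → ℝ}
    (hh : ContDiffAt ℝ ∞ h x) (hh0 : h x ≠ 0)
    (hu : ContDiffAt ℝ ∞ u x) (hu0 : u x ≠ 0) :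
    (h x * (1 / (2 * u x))) * laplacian G a x + gradDot G (fun y => h y * (1 / (2 * u y))) a x
      = (h x * (1 / (2 * u x))) *
        (laplacian G a x + gradDot G (fun y => Real.log ((u y)⁻¹ * h y)) a x) := by
  have e : ∀ i, pd (fun y => h y * (1 / (2 * u y))) i x
      = (h x * (1 / (2 * u x))) * pd (fun y => Real.log ((u y)⁻¹ * h y)) i x := fun i => by
    rw [pd_weight hu hu0 hh hh0, pd_log_inv_mul hu hu0 hh hh0]
  rw [gradDot_const_mul e]; ring

/-! ### The inverse and the Christoffel symbols of the deformed metric -/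

/-- The inverse of `g + a (F ⊗ L + L ⊗ F) + (s + a² h) F ⊗ F`, where `L` is dual to `η`,
`h = L(η)`, `F(η) = 0`, `v` is dual to `F`, `n = F(v)` and `w = (1 + s n)⁻¹`. -/
def deformedInv (gi : Matrix (Fin 3) (Fin 3) ℝ) (v η : Fin 3 → ℝ) (s a n w : ℝ) :
    Matrix (Fin 3) (Fin 3) ℝ :=
  Matrix.of fun i j => gi i j - s * w * (v i * v j) - a * w * (v i * η j + η i * v j)
    + a ^ 2 * n * w * (η i * η j)

theorem deformed_mul_deformedInv {g gi : Matrix (Fin 3) (Fin 3) ℝ} {F L v η : Fin 3 → ℝ}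
    {s a h n w : ℝ} (hgi : g * gi = 1) (hv : ∀ i, ∑ k, g i k * v k = F i)
    (hη : ∀ i, ∑ k, g i k * η k = L i) (hFg : ∀ j, ∑ k, F k * gi k j = v j)
    (hLg : ∀ j, ∑ k, L k * gi k j = η j) (hFη : ∑ k, F k * η k = 0) (hLv : ∑ k, L k * v k = 0)
    (hLη : ∑ k, L k * η k = h) (hFv : ∑ k, F k * v k = n) (hw : w * (1 + s * n) = 1) :
    (Matrix.of fun i j => g i j + a * (F i * L j + L i * F j) + (s + a ^ 2 * h) * (F i * F j))
      * deformedInv gi v η s a n w = 1 := by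
  ext i j
  rw [← hgi, Matrix.mul_apply, Matrix.mul_apply]
  have e1 := hv i
  have e2 := hη i
  have e3 := hFg j
  have e4 := hLg j
  simp only [deformedInv, Matrix.of_apply, Fin.sum_univ_three] at *
  linear_combination (-s * w * v j - a * w * η j) * e1
    + (-a * w * v j + a ^ 2 * n * w * η j) * e2
    + (a * L i + (s + a ^ 2 * h) * F i) * e3 + a * F i * e4
    + (a * L i + (s + a ^ 2 * h) * F i) * (-a * w * v j + a ^ 2 * n * w * η j) * hFη
    + (a * F i) * (-s * w * v j - a * w * η j) * hLv
    + (a * F i) * (-a * w * v j + a ^ 2 * n * w * η j) * hLη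
    + (a * L i + (s + a ^ 2 * h) * F i) * (-s * w * v j - a * w * η j) * hFv
    - (a * F i * η j + (a * L i + (s + a ^ 2 * h) * F i) * v j) * hw

theorem sum_deformedInv_mul (gi : Matrix (Fin 3) (Fin 3) ℝ) (v η : Fin 3 → ℝ) (s a n w : ℝ)
    (T : Fin 3 → Fin 3 → ℝ) :
    ∑ i, ∑ j, deformedInv gi v η s a n w i j * T i j
      = ∑ i, ∑ j, gi i j * T i j - s * w * ∑ i, v i * ∑ j, v j * T i j
        - a * w * (∑ i, v i * ∑ j, η j * T i j + ∑ i, η i * ∑ j, v j * T i j)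
        + a ^ 2 * n * w * ∑ i, η i * ∑ j, η j * T i j := by
  simp only [deformedInv, Matrix.of_apply, Fin.sum_univ_three]; ring

/-- The metric `g + a (df ⊗ η + η ⊗ df) + (u² + a² |η|²) df ⊗ df`. -/
noncomputable def deformed (g : Pt → Matrix (Fin 3) (Fin 3) ℝ) (u f a : Pt → ℝ) (x : Pt) :
    Matrix (Fin 3) (Fin 3) ℝ :=
  Matrix.of fun i j => g x i j + a x * (pd f i x * compPhi g j x + compPhi g i x * pd f j x)
    + (u x ^ 2 + a x ^ 2 * phiPhi g x) * (pd f i x * pd f j x)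

/-- A metric with Killing field `η` and functions invariant near `x`, with `u ≠ 0` and
`1 + u² |∇f|² > 0` at `x`. -/
structure DataAt (g : Pt → Matrix (Fin 3) (Fin 3) ℝ) (u f a : Pt → ℝ) (x : Pt) : Prop where
  killing : KillingAt g x
  u_inv : InvariantAt u x
  f_inv : InvariantAt f x
  a_inv : InvariantAt a x
  u_ne : u x ≠ 0
  w_pos : 0 < wFac g u f x

namespace DataAt

variable {g : Pt → Matrix (Fin 3) (Fin 3) ℝ} {u f a : Pt → ℝ} {x : Pt}

theorem w_ne (h : DataAt g u f a x) : wFac g u f x ≠ 0 := h.w_pos.ne'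

theorem gradDot_eq_sum (g : Pt → Matrix (Fin 3) (Fin 3) ℝ) (F H : Pt → ℝ) (x : Pt) :
    gradDot g F H x = ∑ i, pd F i x * gradUp g H i x := by
  simp only [gradDot, gradUp, Fin.sum_univ_three]; ring

theorem gradDot_comm (hg : MetricAt g x) (F H : Pt → ℝ) : gradDot g F H x = gradDot g H F x := by
  simp only [gradDot, Fin.sum_univ_three, hg.inv_symm 1 0, hg.inv_symm 2 0, hg.inv_symm 2 1]
  ring

theorem sum_compPhi_gradUp (hg : MetricAt g x) {F : Pt → ℝ} (hF : InvariantAt F x) :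
    ∑ i, compPhi g i x * gradUp g F i x = 0 := by
  have e := hF.sum_rot
  simp only [← hg.raise_compPhi] at e
  rw [← e]
  simp only [gradUp, Fin.sum_univ_three, hg.inv_symm 1 0, hg.inv_symm 2 0, hg.inv_symm 2 1]
  ring

theorem sum_rot' {F : Pt → ℝ} (hF : InvariantAt F x) : ∑ j, pd F j x * rot x j = 0 := by
  rw [← hF.sum_rot]; simp only [mul_comm]

theorem deformed_mul (h : DataAt g u f a x) :
    deformed g u f a x * deformedInv (g x)⁻¹ (fun i => gradUp g f i x) (rot x) (u x ^ 2) (a x)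
      (gradDot g f f x) (wFac g u f x)⁻¹ = 1 := by
  have hg := h.killing.toMetricAt
  refine deformed_mul_deformedInv (F := fun i => pd f i x) (L := fun i => compPhi g i x)
    hg.mul_inv (hg.lower_gradUp f) (fun i => rfl) ?_ ?_ (sum_rot' h.f_inv)
    (sum_compPhi_gradUp hg h.f_inv) (MetricAt.phiPhi_eq g x).symm
    (gradDot_eq_sum g f f x).symm (inv_mul_cancel₀ h.w_ne)
  · intro j
    simp only [gradUp]
    exact Finset.sum_congr rfl fun k _ => by rw [hg.inv_symm k j, mul_comm]
  · intro j
    rw [← hg.raise_compPhi]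
    exact Finset.sum_congr rfl fun k _ => by rw [hg.inv_symm k j, mul_comm]

theorem inv_deformed (h : DataAt g u f a x) :
    (deformed g u f a x)⁻¹ = deformedInv (g x)⁻¹ (fun i => gradUp g f i x) (rot x) (u x ^ 2) (a x)
      (gradDot g f f x) (wFac g u f x)⁻¹ :=
  Matrix.inv_eq_right_inv h.deformed_mul

theorem contDiffAt_deformed (h : DataAt g u f a x) (i j : Fin 3) :
    ContDiffAt ℝ ∞ (fun y => deformed g u f a y i j) x := by
  have hg := h.killing.toMetricAt
  have hf := fun i => contDiffAt_pd h.f_inv.smooth i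
  exact ((hg.smooth i j).add (h.a_inv.smooth.mul (((hf i).mul (hg.contDiffAt_compPhi j)).add
    ((hg.contDiffAt_compPhi i).mul (hf j))))).add (((h.u_inv.smooth.pow 2).add
      ((h.a_inv.smooth.pow 2).mul hg.contDiffAt_phiPhi)).mul ((hf i).mul (hf j)))

theorem deformed_symm (hg : g x i j = g x j i) :
    deformed g u f a x i j = deformed g u f a x j i := by
  simp only [deformed, Matrix.of_apply, hg]; ring

theorem metricAt_deformed (h : DataAt g u f a x) : MetricAt (deformed g u f a) x where
  smooth := h.contDiffAt_deformed
  symm := h.killing.symm.mono fun _ hy i j => deformed_symm (hy i j)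
  det_ne := by
    intro h0
    have := congrArg Matrix.det h.deformed_mul
    rw [Matrix.det_mul, h0] at this
    simp at this

theorem pd_deformed (h : DataAt g u f a x) (i j k : Fin 3) :
    pd (fun y => deformed g u f a y i j) k x
      = pd (fun y => g y i j) k x
        + pd a k x * (pd f i x * compPhi g j x + compPhi g i x * pd f j x)
        + a x * (pd (pd f i) k x * compPhi g j x + pd f i x * pd (compPhi g j) k x
          + pd (compPhi g i) k x * pd f j x + compPhi g i x * pd (pd f j) k x)
        + pd (fun y => u y ^ 2 + a y ^ 2 * phiPhi g y) k x * (pd f i x * pd f j x)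
        + (u x ^ 2 + a x ^ 2 * phiPhi g x)
          * (pd (pd f i) k x * pd f j x + pd f i x * pd (pd f j) k x) := by
  have hg := h.killing.toMetricAt
  have hf := fun i => contDiffAt_pd h.f_inv.smooth i
  have hL := hg.contDiffAt_compPhi
  have hψ : ContDiffAt ℝ ∞ (fun y => u y ^ 2 + a y ^ 2 * phiPhi g y) x :=
    (h.u_inv.smooth.pow 2).add ((h.a_inv.smooth.pow 2).mul hg.contDiffAt_phiPhi)
  have c1 := ((hf i).mul (hL j)).add ((hL i).mul (hf j))
  change pd (fun y => g y i j + a y * (pd f i y * compPhi g j y + compPhi g i y * pd f j y)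
    + (u y ^ 2 + a y ^ 2 * phiPhi g y) * (pd f i y * pd f j y)) k x = _
  rw [pd_add ((hg.smooth i j).add (h.a_inv.smooth.mul c1)) (hψ.mul ((hf i).mul (hf j))),
    pd_add (hg.smooth i j) (h.a_inv.smooth.mul c1), pd_mul h.a_inv.smooth c1,
    pd_add ((hf i).mul (hL j)) ((hL i).mul (hf j)), pd_mul (hf i) (hL j), pd_mul (hL i) (hf j),
    pd_mul hψ ((hf i).mul (hf j)), pd_mul (hf i) (hf j)]
  ring

/-- Christoffel symbols of the deformed metric. By symmetry of the second derivatives of `f`, those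
second derivatives occur only in the form `f_{ij}`, and the Killing equation turns the symmetrized
derivative of `η` into Christoffel symbols of `g`. -/
theorem chrLow_deformed (h : DataAt g u f a x) (m i j : Fin 3) :
    chrLow (deformed g u f a) m i j x = chrLow g m i j x + 1 / 2 *
      (pd a i x * (pd f j x * compPhi g m x + compPhi g j x * pd f m x)
        + pd a j x * (pd f i x * compPhi g m x + compPhi g i x * pd f m x)
        - pd a m x * (pd f i x * compPhi g j x + compPhi g i x * pd f j x)
        + a x * (2 * pd (pd f j) i x * compPhi g m x + 2 * pd f j x * covEta g i m x
          + 2 * pd f i x * covEta g j m x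
          + pd f m x * (2 * ∑ l, rot x l * chrLow g l i j x))
        + pd (fun y => u y ^ 2 + a y ^ 2 * phiPhi g y) i x * (pd f j x * pd f m x)
        + pd (fun y => u y ^ 2 + a y ^ 2 * phiPhi g y) j x * (pd f i x * pd f m x)
        - pd (fun y => u y ^ 2 + a y ^ 2 * phiPhi g y) m x * (pd f i x * pd f j x)
        + 2 * (u x ^ 2 + a x ^ 2 * phiPhi g x) * pd (pd f j) i x * pd f m x) := by
  rw [← h.killing.pd_compPhi_add]
  have c1 := pd_comm h.f_inv.smooth i j
  have c2 := pd_comm h.f_inv.smooth i m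
  have c3 := pd_comm h.f_inv.smooth j m
  simp only [chrLow, h.pd_deformed, covEta, c1, c2, c3]
  ring

/-- The gradient of an invariant function for the deformed metric. -/
theorem gradUp_deformed (h : DataAt g u f a x) {F : Pt → ℝ} (hF : InvariantAt F x) (i : Fin 3) :
    gradUp (deformed g u f a) F i x = gradUp g F i x
      - (wFac g u f x)⁻¹ * gradDot g F f x * (u x ^ 2 * gradUp g f i x + a x * rot x i) := by
  have e := sum_rot' hF
  rw [gradUp, h.inv_deformed, gradDot_eq_sum g F f]
  simp only [deformedInv, Matrix.of_apply, Fin.sum_univ_three] at e ⊢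
  rw [gradUp.eq_1 g F]
  simp only [Fin.sum_univ_three]
  linear_combination (-a x * (wFac g u f x)⁻¹ * gradUp g f i x
    + a x ^ 2 * gradDot g f f x * (wFac g u f x)⁻¹ * rot x i) * e

end DataAt

/-! ### The Hessian for the deformed metric -/

namespace DataAt

variable {g : Pt → Matrix (Fin 3) (Fin 3) ℝ} {u f a : Pt → ℝ} {x : Pt}

/-- `u² + a² |η|²`, the coefficient of `df ⊗ df` in the deformed metric. -/
noncomputable def psi (g : Pt → Matrix (Fin 3) (Fin 3) ℝ) (u a : Pt → ℝ) (y : Pt) : ℝ :=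
  u y ^ 2 + a y ^ 2 * phiPhi g y

theorem pd_psi (h : DataAt g u f a x) (i : Fin 3) :
    pd (psi g u a) i x = 2 * u x * pd u i x + 2 * a x * phiPhi g x * pd a i x
      + a x ^ 2 * pd (phiPhi g) i x := by
  have hu := h.u_inv.smooth
  have ha := h.a_inv.smooth
  have hh := h.killing.contDiffAt_phiPhi
  have e : psi g u a = fun y => u y * u y + a y * a y * phiPhi g y := by
    funext y; rw [psi]; ring
  rw [e, pd_add (hu.mul hu) ((ha.mul ha).mul hh), pd_mul hu hu, pd_mul (ha.mul ha) hh,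
    pd_mul ha ha]
  ring

/-- The contraction `β^m = G^{mk} ∂_k a` of the Killing tensor `∇_i η_m` with the gradient of `a`
for the deformed metric. -/
noncomputable def twist (g : Pt → Matrix (Fin 3) (Fin 3) ℝ) (u f a : Pt → ℝ) (x : Pt)
    (i : Fin 3) : ℝ :=
  ∑ m, covEta g i m x * gradUp (deformed g u f a) a m x

theorem sum_compPhi_gradUp_deformed (h : DataAt g u f a x) {F : Pt → ℝ} (hF : InvariantAt F x) :
    ∑ m, compPhi g m x * gradUp (deformed g u f a) F m x
      = -a x * (wFac g u f x)⁻¹ * gradDot g F f x * phiPhi g x := by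
  have e1 := sum_compPhi_gradUp h.killing.toMetricAt hF
  have e2 := sum_compPhi_gradUp h.killing.toMetricAt h.f_inv
  have e3 := MetricAt.phiPhi_eq g x
  simp only [h.gradUp_deformed hF, Fin.sum_univ_three] at *
  linear_combination e1 - (wFac g u f x)⁻¹ * gradDot g F f x * u x ^ 2 * e2
    + a x * (wFac g u f x)⁻¹ * gradDot g F f x * e3

theorem sum_pd_gradUp_deformed (h : DataAt g u f a x) {F H : Pt → ℝ} (hF : InvariantAt F x)
    (hH : ∑ m, pd H m x * rot x m = 0) :
    ∑ m, pd H m x * gradUp (deformed g u f a) F m x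
      = gradDot g H F x
        - u x ^ 2 * (wFac g u f x)⁻¹ * gradDot g F f x * gradDot g H f x := by
  rw [gradDot_eq_sum g H F, gradDot_eq_sum g H f]
  simp only [h.gradUp_deformed hF, Fin.sum_univ_three] at *
  linear_combination (-a x * (wFac g u f x)⁻¹ * gradDot g F f x) * hH

theorem sum_pd_f_gradUp_deformed (h : DataAt g u f a x) {F : Pt → ℝ} (hF : InvariantAt F x) :
    ∑ m, pd f m x * gradUp (deformed g u f a) F m x
      = (wFac g u f x)⁻¹ * gradDot g F f x := by
  rw [h.sum_pd_gradUp_deformed hF (sum_rot' h.f_inv), gradDot_comm h.killing.toMetricAt f F]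
  have hw : (wFac g u f x)⁻¹ * (1 + u x ^ 2 * gradDot g f f x) = 1 := inv_mul_cancel₀ h.w_ne
  linear_combination -gradDot g F f x * hw

/-- The difference of the Hessians of `a` for the deformed metric and for `g`. The terms
with `∂_i η_j + ∂_j η_i` cancel against the `η` component of the deformed gradient of `a`, so that
only the antisymmetric part of `∂η` remains. -/
theorem hess_deformed (h : DataAt g u f a x) (i j : Fin 3) :
    hess (deformed g u f a) a i j x = hess g a i j x
      - u x ^ 2 * (wFac g u f x)⁻¹ * gradDot g a f x * hess g f i j x
      - 1 / 2 * ((pd a i x * pd f j x + pd f i x * pd a j x)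
            * ∑ m, compPhi g m x * gradUp (deformed g u f a) a m x
        + (pd a i x * compPhi g j x + compPhi g i x * pd a j x)
            * ∑ m, pd f m x * gradUp (deformed g u f a) a m x
        - (pd f i x * compPhi g j x + compPhi g i x * pd f j x)
            * ∑ m, pd a m x * gradUp (deformed g u f a) a m x
        + 2 * a x * (twist g u f a x i * pd f j x + pd f i x * twist g u f a x j)
        + (pd (psi g u a) i x * pd f j x + pd f i x * pd (psi g u a) j x)
            * ∑ m, pd f m x * gradUp (deformed g u f a) a m x
        - (∑ m, pd (psi g u a) m x * gradUp (deformed g u f a) a m x)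
            * (pd f i x * pd f j x)) := by
  have hL := h.sum_compPhi_gradUp_deformed h.a_inv
  have hF := h.sum_pd_f_gradUp_deformed h.a_inv
  have hg := h.killing.toMetricAt
  have e1 : ∑ m, gradUp (deformed g u f a) a m x * chrLow g m i j x
      = ∑ m, gradUp g a m x * chrLow g m i j x - (wFac g u f x)⁻¹ * gradDot g a f x
        * (u x ^ 2 * ∑ m, gradUp g f m x * chrLow g m i j x
          + a x * ∑ m, rot x m * chrLow g m i j x) := by
    simp only [h.gradUp_deformed h.a_inv, Fin.sum_univ_three]; ring
  rw [h.metricAt_deformed.hess_eq, hg.hess_eq, hg.hess_eq]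
  simp only [h.chrLow_deformed, twist, ← psi.eq_1]
  generalize gradUp (deformed g u f a) a = V at *
  set X := ∑ m, rot x m * chrLow g m i j x
  simp only [Fin.sum_univ_three] at hL hF e1 ⊢
  have hψ : psi g u a x = u x ^ 2 + a x ^ 2 * phiPhi g x := rfl
  rw [hψ] at *
  linear_combination -e1 - a x * pd (pd f j) i x * hL
    - (a x * X + (u x ^ 2 + a x ^ 2 * phiPhi g x) * pd (pd f j) i x) * hF

end DataAt

/-! ### The Laplacian for the deformed metric -/

namespace DataAt

variable {g : Pt → Matrix (Fin 3) (Fin 3) ℝ} {u f a : Pt → ℝ} {x : Pt}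

theorem sum_hess_rot_gradUp (hg : KillingAt g x) {F : Pt → ℝ} (hF : InvariantAt F x)
    (v : Fin 3 → ℝ) :
    ∑ i, v i * ∑ j, rot x j * hess g F i j x
      = -∑ i, v i * ∑ m, covEta g i m x * gradUp g F m x := by
  simp only [hg.hess_rot hF, mul_neg, Finset.sum_neg_distrib]

theorem sum_hess_gradUp_rot (hg : KillingAt g x) {F : Pt → ℝ} (hF : InvariantAt F x)
    (v : Fin 3 → ℝ) :
    ∑ i, rot x i * ∑ j, v j * hess g F i j x
      = -∑ i, v i * ∑ m, covEta g i m x * gradUp g F m x := by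
  rw [← sum_hess_rot_gradUp hg hF]
  simp only [Fin.sum_univ_three, hg.hess_symm hF.smooth 1 0, hg.hess_symm hF.smooth 2 0,
    hg.hess_symm hF.smooth 2 1]
  ring

theorem sum_rot_covEta_mul (hg : KillingAt g x) (v : Fin 3 → ℝ) :
    ∑ i, rot x i * ∑ m, covEta g i m x * v m = -(1 / 2) * ∑ m, pd (phiPhi g) m x * v m := by
  have e0 := hg.sum_rot_covEta 0
  have e1 := hg.sum_rot_covEta 1
  have e2 := hg.sum_rot_covEta 2
  simp only [Fin.sum_univ_three] at *
  linear_combination v 0 * e0 + v 1 * e1 + v 2 * e2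

theorem sum_covEta_rot (hg : KillingAt g x) (v : Fin 3 → ℝ) :
    ∑ i, v i * ∑ m, covEta g i m x * rot x m = 1 / 2 * ∑ m, pd (phiPhi g) m x * v m := by
  have e := sum_rot_covEta_mul hg v
  simp only [Fin.sum_univ_three, covEta] at *
  linear_combination -e

theorem sum_covEta_self (g : Pt → Matrix (Fin 3) (Fin 3) ℝ) (x : Pt) (v : Fin 3 → ℝ) :
    ∑ i, v i * ∑ m, covEta g i m x * v m = 0 := by
  simp only [Fin.sum_univ_three, covEta]
  ring

/-- The trace of a Hessian with respect to the deformed metric, in terms of `g`. -/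
theorem sum_inv_mul_hess (h : DataAt g u f a x) {F : Pt → ℝ} (hF : InvariantAt F x) :
    ∑ i, ∑ j, (deformed g u f a x)⁻¹ i j * hess g F i j x
      = laplacian g F x
        - u x ^ 2 * (wFac g u f x)⁻¹
          * ∑ i, gradUp g f i x * ∑ j, gradUp g f j x * hess g F i j x
        + 2 * a x * (wFac g u f x)⁻¹
          * ∑ i, gradUp g f i x * ∑ m, covEta g i m x * gradUp g F m x
        + 1 / 2 * a x ^ 2 * gradDot g f f x * (wFac g u f x)⁻¹ * gradDot g (phiPhi g) F x := by
  rw [h.inv_deformed, sum_deformedInv_mul, sum_hess_rot_gradUp h.killing hF,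
    sum_hess_gradUp_rot h.killing hF, sum_hess_rot_gradUp h.killing hF,
    sum_rot_covEta_mul h.killing, ← gradDot_eq_sum, laplacian]
  ring

theorem sum_inv_mul_pd (g : Pt → Matrix (Fin 3) (Fin 3) ℝ) (u f a : Pt → ℝ) (x : Pt) (α : Fin 3 → ℝ) (F : Pt → ℝ) :
    ∑ i, ∑ j, (deformed g u f a x)⁻¹ i j * (α i * pd F j x)
      = ∑ i, α i * gradUp (deformed g u f a) F i x := by
  simp only [gradUp, Fin.sum_univ_three]; ring

theorem phiPhi_rot (hg : KillingAt g x) : ∑ j, pd (phiPhi g) j x * rot x j = 0 := by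
  rw [← hg.phiPhi_inv, lieFun]; simp only [mul_comm]

theorem sum_twist_gradUp (h : DataAt g u f a x) :
    ∑ i, twist g u f a x i * gradUp (deformed g u f a) f i x
      = (wFac g u f x)⁻¹ * (∑ i, gradUp g f i x * ∑ m, covEta g i m x * gradUp g a m x
          - 1 / 2 * a x * (wFac g u f x)⁻¹ * gradDot g a f x * gradDot g (phiPhi g) f x)
        + 1 / 2 * a x * (wFac g u f x)⁻¹ * gradDot g f f x * (gradDot g (phiPhi g) a x
          - u x ^ 2 * (wFac g u f x)⁻¹ * gradDot g a f x * gradDot g (phiPhi g) f x) := by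
  have h1 : ∑ i, gradUp g f i x * twist g u f a x i
      = ∑ i, gradUp g f i x * ∑ m, covEta g i m x * gradUp g a m x
          - 1 / 2 * a x * (wFac g u f x)⁻¹ * gradDot g a f x * gradDot g (phiPhi g) f x := by
    have e1 := sum_covEta_self g x fun i => gradUp g f i x
    have e2 := sum_covEta_rot h.killing fun i => gradUp g f i x
    rw [gradDot_eq_sum g (phiPhi g) f]
    simp only [twist, h.gradUp_deformed h.a_inv, Fin.sum_univ_three] at *
    linear_combination
      -(wFac g u f x)⁻¹ * gradDot g a f x * u x ^ 2 * e1
        - (wFac g u f x)⁻¹ * gradDot g a f x * a x * e2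
  have h2 : ∑ i, rot x i * twist g u f a x i
      = -(1 / 2) * (gradDot g (phiPhi g) a x
          - u x ^ 2 * (wFac g u f x)⁻¹ * gradDot g a f x * gradDot g (phiPhi g) f x) := by
    rw [← h.sum_pd_gradUp_deformed h.a_inv (phiPhi_rot h.killing),
      ← sum_rot_covEta_mul h.killing]
    rfl
  have hw : (wFac g u f x)⁻¹ * (1 + u x ^ 2 * gradDot g f f x) = 1 := inv_mul_cancel₀ h.w_ne
  simp only [h.gradUp_deformed h.f_inv]
  generalize ∑ i, gradUp g f i x * ∑ m, covEta g i m x * gradUp g a m x = t at h1 ⊢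
  simp only [Fin.sum_univ_three] at h1 h2 ⊢
  linear_combination (1 - (wFac g u f x)⁻¹ * gradDot g f f x * u x ^ 2) * h1
    - (wFac g u f x)⁻¹ * gradDot g f f x * a x * h2
    - (t
          - 1 / 2 * a x * (wFac g u f x)⁻¹ * gradDot g a f x * gradDot g (phiPhi g) f x) * hw

theorem sum_psi_gradUp (h : DataAt g u f a x) {F : Pt → ℝ} :
    ∑ i, pd (psi g u a) i x * gradUp (deformed g u f a) F i x
      = 2 * u x * ∑ i, pd u i x * gradUp (deformed g u f a) F i x
        + 2 * a x * phiPhi g x * ∑ i, pd a i x * gradUp (deformed g u f a) F i x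
        + a x ^ 2 * ∑ i, pd (phiPhi g) i x * gradUp (deformed g u f a) F i x := by
  simp only [h.pd_psi, Fin.sum_univ_three]; ring

/-- The Laplacian of `a` for the deformed metric, in terms of `g`. -/
theorem laplacian_deformed (h : DataAt g u f a x) :
    laplacian (deformed g u f a) a x
      = laplacian g a x - u x ^ 2 * (wFac g u f x)⁻¹
          * ∑ i, gradUp g f i x * ∑ j, gradUp g f j x * hess g a i j x
        - u x ^ 2 * (wFac g u f x)⁻¹ * gradDot g a f x
          * (laplacian g f x - u x ^ 2 * (wFac g u f x)⁻¹
            * ∑ i, gradUp g f i x * ∑ j, gradUp g f j x * hess g f i j x)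
        - 2 * u x * gradDot g u f x * gradDot g a f x * (wFac g u f x)⁻¹ ^ 2
        + u x * gradDot g f f x * (wFac g u f x)⁻¹ * (gradDot g u a x
          - u x ^ 2 * (wFac g u f x)⁻¹ * gradDot g a f x * gradDot g u f x) := by
  have hs := h.metricAt_deformed.inv_symm
  have e : laplacian (deformed g u f a) a x
      = ∑ i, ∑ j, (deformed g u f a x)⁻¹ i j * hess g a i j x
      - u x ^ 2 * (wFac g u f x)⁻¹ * gradDot g a f x
        * ∑ i, ∑ j, (deformed g u f a x)⁻¹ i j * hess g f i j x
      - ((∑ i, ∑ j, (deformed g u f a x)⁻¹ i j * (pd a i x * pd f j x))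
            * ∑ m, compPhi g m x * gradUp (deformed g u f a) a m x
        + (∑ i, ∑ j, (deformed g u f a x)⁻¹ i j * (compPhi g i x * pd a j x))
            * ∑ m, pd f m x * gradUp (deformed g u f a) a m x
        - (∑ i, ∑ j, (deformed g u f a x)⁻¹ i j * (compPhi g i x * pd f j x))
            * ∑ m, pd a m x * gradUp (deformed g u f a) a m x
        + 2 * a x * (∑ i, ∑ j, (deformed g u f a x)⁻¹ i j * (twist g u f a x i * pd f j x))
        + (∑ i, ∑ j, (deformed g u f a x)⁻¹ i j * (pd (psi g u a) i x * pd f j x))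
            * ∑ m, pd f m x * gradUp (deformed g u f a) a m x
        - 1 / 2 * (∑ m, pd (psi g u a) m x * gradUp (deformed g u f a) a m x)
            * (∑ i, ∑ j, (deformed g u f a x)⁻¹ i j * (pd f i x * pd f j x))) := by
    simp only [laplacian, h.hess_deformed]
    generalize ∑ m, compPhi g m x * gradUp (deformed g u f a) a m x = c1
    generalize ∑ m, pd f m x * gradUp (deformed g u f a) a m x = c2
    generalize ∑ m, pd a m x * gradUp (deformed g u f a) a m x = c3
    generalize ∑ m, pd (psi g u a) m x * gradUp (deformed g u f a) a m x = c4
    simp only [Fin.sum_univ_three, hs 1 0, hs 2 0, hs 2 1]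
    ring
  rw [e, h.sum_inv_mul_hess h.a_inv, h.sum_inv_mul_hess h.f_inv]
  simp only [sum_inv_mul_pd, h.sum_psi_gradUp, h.sum_twist_gradUp,
    h.sum_compPhi_gradUp_deformed h.a_inv, h.sum_compPhi_gradUp_deformed h.f_inv,
    h.sum_pd_f_gradUp_deformed h.a_inv, h.sum_pd_f_gradUp_deformed h.f_inv,
    h.sum_pd_gradUp_deformed h.f_inv (sum_rot' h.a_inv),
    h.sum_pd_gradUp_deformed h.f_inv (sum_rot' h.u_inv),
    h.sum_pd_gradUp_deformed h.f_inv (phiPhi_rot h.killing),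
    h.sum_pd_gradUp_deformed h.a_inv (sum_rot' h.a_inv),
    h.sum_pd_gradUp_deformed h.a_inv (sum_rot' h.u_inv),
    h.sum_pd_gradUp_deformed h.a_inv (phiPhi_rot h.killing),
    sum_covEta_self]
  have hw : gradDot g f f x = (wFac g u f x - 1) / u x ^ 2 := by
    have := h.u_ne
    rw [wFac]; field_simp; ring
  have h1 := h.u_ne
  have h2 := h.w_ne
  rw [hw]
  field_simp
  ring

end DataAt

/-! ### The equation with respect to `g` -/

namespace DataAt

variable {g : Pt → Matrix (Fin 3) (Fin 3) ℝ} {u f a : Pt → ℝ} {x : Pt}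

theorem piForm_div_sqrt (h : DataAt g u f a x) (i j : Fin 3) :
    piForm g u f a i j x / Real.sqrt (wFac g u f x)
      = (u x * hess g f i j x + pd u i x * pd f j x + pd u j x * pd f i x
      + 1 / (2 * u x) * (compPhi g i x * pd a j x + compPhi g j x * pd a i x))
        * (wFac g u f x)⁻¹ := by
  rw [piForm, div_div, Real.mul_self_sqrt h.w_pos.le, div_eq_mul_inv]

/-- The contraction of a covector product with `g^{ij} - u² f^i f^j / W`. -/
theorem sum_projected_mul_pd (g : Pt → Matrix (Fin 3) (Fin 3) ℝ) (u f : Pt → ℝ) (x : Pt)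
    (α : Fin 3 → ℝ) (F : Pt → ℝ) :
    ∑ i, ∑ j, ((g x)⁻¹ i j - u x ^ 2 * gradUp g f i x * gradUp g f j x / wFac g u f x)
        * (α i * pd F j x)
      = ∑ i, α i * gradUp g F i x
        - u x ^ 2 * (wFac g u f x)⁻¹ * gradDot g F f x * ∑ i, α i * gradUp g f i x := by
  rw [gradDot_eq_sum g F f]
  have e : ∀ i, gradUp g F i x = ∑ j, (g x)⁻¹ i j * pd F j x := fun _ => rfl
  simp only [e, Fin.sum_univ_three]
  ring

theorem sum_projected_mul (g : Pt → Matrix (Fin 3) (Fin 3) ℝ) (u f F : Pt → ℝ) (x : Pt) :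
    ∑ i, ∑ j, ((g x)⁻¹ i j - u x ^ 2 * gradUp g f i x * gradUp g f j x / wFac g u f x)
        * hess g F i j x
      = laplacian g F x - u x ^ 2 * (wFac g u f x)⁻¹
          * ∑ i, gradUp g f i x * ∑ j, gradUp g f j x * hess g F i j x := by
  simp only [laplacian, Fin.sum_univ_three]
  ring

theorem laplacian_add_eq_elliptic (h : DataAt g u f a x) (hh : phiPhi g x ≠ 0) :
    laplacian (deformed g u f a) a x
        + gradDot (deformed g u f a) (fun y => Real.log ((u y)⁻¹ * phiPhi g y)) a x
      = (∑ i, ∑ j,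
        ((g x)⁻¹ i j - u x ^ 2 * gradUp g f i x * gradUp g f j x / wFac g u f x)
          * (hess g a i j x
            - ∑ l, u x * piForm g u f a i j x * gradUp g f l x / Real.sqrt (wFac g u f x)
                * pd a l x))
      + (∑ i, ∑ j,
        ((g x)⁻¹ i j - u x ^ 2 * gradUp g f i x * gradUp g f j x / wFac g u f x)
          * (pd (fun y => Real.log (phiPhi g y)) i x
            - pd (fun y => Real.log (u y)) i x / wFac g u f x)
          * pd a j x) := by
  have hg := h.killing.toMetricAt
  have hφ := hg.contDiffAt_phiPhi
  have e1 : gradDot (deformed g u f a) (fun y => Real.log ((u y)⁻¹ * phiPhi g y)) a x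
      = (phiPhi g x)⁻¹ * ∑ i, pd (phiPhi g) i x * gradUp (deformed g u f a) a i x
        - (u x)⁻¹ * ∑ i, pd u i x * gradUp (deformed g u f a) a i x := by
    rw [gradDot_eq_sum]
    simp only [pd_log_inv_mul h.u_inv.smooth h.u_ne hφ hh, Fin.sum_univ_three]
    ring
  have e2 : ∀ i j, ∑ l, u x * piForm g u f a i j x * gradUp g f l x / Real.sqrt (wFac g u f x)
        * pd a l x
      = u x * gradDot g a f x * (wFac g u f x)⁻¹
        * (u x * hess g f i j x + pd u i x * pd f j x + pd f i x * pd u j x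
      + 1 / (2 * u x) * (compPhi g i x * pd a j x + compPhi g j x * pd a i x)) := by
    intro i j
    have := h.piForm_div_sqrt i j
    rw [gradDot_eq_sum]
    simp only [Fin.sum_univ_three]
    linear_combination u x * (pd a 0 x * gradUp g f 0 x + pd a 1 x * gradUp g f 1 x
      + pd a 2 x * gradUp g f 2 x) * this
  have hK : ∀ i j,
      ((g x)⁻¹ i j - u x ^ 2 * gradUp g f i x * gradUp g f j x / wFac g u f x)
      = (g x)⁻¹ j i - u x ^ 2 * gradUp g f j x * gradUp g f i x / wFac g u f x := by
    intro i j
    rw [hg.inv_symm i j]; ring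
  have huf := sum_projected_mul_pd g u f x (fun i => pd u i x) f
  have hLa := sum_projected_mul_pd g u f x (fun i => compPhi g i x) a
  have hua := sum_projected_mul_pd g u f x (fun i => pd u i x) a
  have hha := sum_projected_mul_pd g u f x (fun i => pd (phiPhi g) i x) a
  have hHa := sum_projected_mul g u f a x
  have hHf := sum_projected_mul g u f f x
  rw [sum_compPhi_gradUp hg h.a_inv, sum_compPhi_gradUp hg h.f_inv] at hLa
  rw [← gradDot_eq_sum] at huf
  rw [← gradDot_eq_sum, ← gradDot_eq_sum] at hua hha
  rw [e1, h.sum_pd_gradUp_deformed h.a_inv (sum_rot' h.u_inv),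
    h.sum_pd_gradUp_deformed h.a_inv (phiPhi_rot h.killing), h.laplacian_deformed]
  simp only [e2, pd_log hφ hh, pd_log h.u_inv.smooth h.u_ne]
  set K : Fin 3 → Fin 3 → ℝ := fun i j =>
    (g x)⁻¹ i j - u x ^ 2 * gradUp g f i x * gradUp g f j x / wFac g u f x with hKdef
  have hKs : ∀ i j, K i j = K j i := hK
  have hKe : ∀ i j, (g x)⁻¹ i j - u x ^ 2 * gradUp g f i x * gradUp g f j x / wFac g u f x
      = K i j := fun _ _ => rfl
  simp only [hKe] at huf hLa hua hha hHa hHf ⊢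
  have e3 : (∑ i, ∑ j, K i j * (hess g a i j x - u x * gradDot g a f x * (wFac g u f x)⁻¹
        * (u x * hess g f i j x + pd u i x * pd f j x + pd f i x * pd u j x
      + 1 / (2 * u x) * (compPhi g i x * pd a j x + compPhi g j x * pd a i x))))
      + ∑ i, ∑ j, K i j * (pd (phiPhi g) i x / phiPhi g x - pd u i x / u x / wFac g u f x)
          * pd a j x
      = ∑ i, ∑ j, K i j * hess g a i j x
        - u x * gradDot g a f x * (wFac g u f x)⁻¹ * (u x * ∑ i, ∑ j, K i j * hess g f i j x
          + 2 * ∑ i, ∑ j, K i j * (pd u i x * pd f j x)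
          + 1 / u x * ∑ i, ∑ j, K i j * (compPhi g i x * pd a j x))
        + 1 / phiPhi g x * ∑ i, ∑ j, K i j * (pd (phiPhi g) i x * pd a j x)
        - 1 / u x * (wFac g u f x)⁻¹ * ∑ i, ∑ j, K i j * (pd u i x * pd a j x) := by
    clear_value K
    simp only [Fin.sum_univ_three, hKs 1 0, hKs 2 0, hKs 2 1]
    ring
  rw [e3, huf, hLa, hua, hha, hHa, hHf]
  have hw : gradDot g f f x = (wFac g u f x - 1) / u x ^ 2 := by
    have := h.u_ne
    rw [wFac]; field_simp; ring
  have h1 := h.u_ne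
  have h2 := h.w_ne
  rw [hw]
  field_simp
  ring

end DataAt

/-! ### Change of coordinates -/

/-- The Jacobian matrix `∂_p Ψ^a`. -/
noncomputable def jac (Ψ : Pt → Pt) (s : Pt) : Matrix (Fin 3) (Fin 3) ℝ :=
  Matrix.of fun a p => pd (fun y => Ψ y a) p s

/-- `K` is the pull-back of the metric `G` under `Ψ` near `q`. -/
structure PullbackAt (G K : Pt → Matrix (Fin 3) (Fin 3) ℝ) (Ψ : Pt → Pt) (q : Pt) : Prop where
  smooth : ContDiffAt ℝ ∞ Ψ q
  source : MetricAt K q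
  target : MetricAt G (Ψ q)
  metric : ∀ᶠ s in 𝓝 q, ∀ p r, K s p r = ∑ a, ∑ b, G (Ψ s) a b * (jac Ψ s a p * jac Ψ s b r)

namespace PullbackAt

variable {G K : Pt → Matrix (Fin 3) (Fin 3) ℝ} {Ψ : Pt → Pt} {q : Pt}

theorem contDiffAt_apply (h : PullbackAt G K Ψ q) (a : Fin 3) :
    ContDiffAt ℝ ∞ (fun s => Ψ s a) q :=
  contDiffAt_pi.1 h.smooth a

theorem contDiffAt_jac (h : PullbackAt G K Ψ q) (a p : Fin 3) :
    ContDiffAt ℝ ∞ (fun s => jac Ψ s a p) q :=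
  contDiffAt_pd (h.contDiffAt_apply a) p

theorem pd_jac_comm (h : PullbackAt G K Ψ q) (a p r : Fin 3) :
    pd (fun s => jac Ψ s a p) r q = pd (fun s => jac Ψ s a r) p q :=
  pd_comm (h.contDiffAt_apply a) p r

theorem eq_transpose_mul (h : PullbackAt G K Ψ q) :
    K q = (jac Ψ q).transpose * G (Ψ q) * jac Ψ q := by
  ext p r
  rw [h.metric.self_of_nhds p r]
  simp only [Matrix.mul_apply, Matrix.transpose_apply, Fin.sum_univ_three]
  ring

theorem jac_mul_inv_mul (h : PullbackAt G K Ψ q) :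
    jac Ψ q * (K q)⁻¹ * (jac Ψ q).transpose = (G (Ψ q))⁻¹ := by
  have hJ : IsUnit (jac Ψ q).det := by
    rw [isUnit_iff_ne_zero]
    intro h0
    apply h.source.det_ne
    rw [h.eq_transpose_mul, Matrix.det_mul, h0, mul_zero]
  have hJt : IsUnit (jac Ψ q).transpose.det := by rwa [Matrix.det_transpose]
  rw [h.eq_transpose_mul, Matrix.mul_inv_rev, Matrix.mul_inv_rev, ← Matrix.mul_assoc,
    ← Matrix.mul_assoc, Matrix.mul_nonsing_inv _ hJ, Matrix.one_mul, Matrix.mul_assoc,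
    Matrix.nonsing_inv_mul _ hJt, Matrix.mul_one]

theorem sum_inv (h : PullbackAt G K Ψ q) (a b : Fin 3) :
    ∑ p, ∑ r, (K q)⁻¹ p r * (jac Ψ q a p * jac Ψ q b r) = (G (Ψ q))⁻¹ a b := by
  rw [← h.jac_mul_inv_mul]
  simp only [Matrix.mul_apply, Matrix.transpose_apply, Fin.sum_univ_three]
  ring

theorem pd_comp (h : PullbackAt G K Ψ q) {F : Pt → ℝ} (hF : ContDiffAt ℝ ∞ F (Ψ q)) (p : Fin 3) :
    pd (fun s => F (Ψ s)) p q = ∑ a, pd F a (Ψ q) * jac Ψ q a p :=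
  AxiData.pd_comp (hF.differentiableAt (by simp)) (h.smooth.differentiableAt (by simp)) p

theorem pd_pd_comp (h : PullbackAt G K Ψ q) {F : Pt → ℝ} (hF : ContDiffAt ℝ ∞ F (Ψ q))
    (p r : Fin 3) :
    pd (pd (fun s => F (Ψ s)) r) p q
      = ∑ a, ((∑ b, pd (pd F a) b (Ψ q) * jac Ψ q b p) * jac Ψ q a r
          + pd F a (Ψ q) * pd (fun s => jac Ψ s a r) p q) := by
  have e : pd (fun s => F (Ψ s)) r =ᶠ[𝓝 q] fun s => ∑ a, pd F a (Ψ s) * jac Ψ s a r := by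
    have h1 : ∀ᶠ s in 𝓝 q, ContDiffAt ℝ 1 F (Ψ s) :=
      h.smooth.continuousAt.eventually
        ((hF.of_le (by exact_mod_cast le_top)).eventually (by simp))
    have h2 : ∀ᶠ s in 𝓝 q, ContDiffAt ℝ 1 Ψ s :=
      (h.smooth.of_le (by exact_mod_cast le_top)).eventually (by simp)
    filter_upwards [h1, h2] with s h1 h2
    exact AxiData.pd_comp (h1.differentiableAt (by simp)) (h2.differentiableAt (by simp)) r
  have hc : ∀ a, ContDiffAt ℝ ∞ (fun s => pd F a (Ψ s)) q :=
    fun a => (contDiffAt_pd hF a).comp q h.smooth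
  rw [pd_congr e, pd_sum fun a => (hc a).mul (h.contDiffAt_jac a r)]
  refine Finset.sum_congr rfl fun a _ => ?_
  rw [pd_mul (hc a) (h.contDiffAt_jac a r), h.pd_comp (contDiffAt_pd hF a)]
  ring

theorem pd_metric (h : PullbackAt G K Ψ q) (p r k : Fin 3) :
    pd (fun s => K s p r) k q
      = ∑ a, ∑ b, ((∑ c, pd (fun y => G y a b) c (Ψ q) * jac Ψ q c k)
            * (jac Ψ q a p * jac Ψ q b r)
          + G (Ψ q) a b * (pd (fun s => jac Ψ s a p) k q * jac Ψ q b r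
            + jac Ψ q a p * pd (fun s => jac Ψ s b r) k q)) := by
  have hc : ∀ a b, ContDiffAt ℝ ∞ (fun s => G (Ψ s) a b) q :=
    fun a b => (h.target.smooth a b).comp q h.smooth
  have hJ := h.contDiffAt_jac
  rw [pd_congr (h.metric.mono fun s hs => hs p r),
    pd_sum fun a => ContDiffAt.sum fun b _ => (hc a b).mul ((hJ a p).mul (hJ b r))]
  refine Finset.sum_congr rfl fun a _ => ?_
  rw [pd_sum fun b => (hc a b).mul ((hJ a p).mul (hJ b r))]
  refine Finset.sum_congr rfl fun b _ => ?_
  rw [pd_mul (hc a b) ((hJ a p).mul (hJ b r)), pd_mul (hJ a p) (hJ b r),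
    h.pd_comp (h.target.smooth a b)]
  ring

/-- The transformation law of Christoffel symbols of the first kind. -/
theorem chrLow_eq (h : PullbackAt G K Ψ q) (m p r : Fin 3) :
    chrLow K m p r q
      = ∑ c, jac Ψ q c m * ((∑ a, ∑ b, jac Ψ q a p * jac Ψ q b r * chrLow G c a b (Ψ q))
        + ∑ a, G (Ψ q) c a * pd (fun s => jac Ψ s a r) p q) := by
  have c1 := fun a => h.pd_jac_comm a p r
  have c2 := fun a => h.pd_jac_comm a m r
  have c3 := fun a => h.pd_jac_comm a m p
  have s := h.target.symm_self
  have d := h.target.pd_symm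
  simp only [chrLow, h.pd_metric, c1, c2, c3]
  simp only [Fin.sum_univ_three, s 1 0, s 2 0, s 2 1, d 1 0, d 2 0, d 2 1]
  ring

theorem sum_jac_gradUp (h : PullbackAt G K Ψ q) {F : Pt → ℝ} (hF : ContDiffAt ℝ ∞ F (Ψ q))
    (c : Fin 3) :
    ∑ m, jac Ψ q c m * gradUp K (fun s => F (Ψ s)) m q = gradUp G F c (Ψ q) := by
  simp only [gradUp, ← h.sum_inv, h.pd_comp hF, Fin.sum_univ_three]
  ring

/-- The Hessian is a tensor. -/
theorem hess_eq (h : PullbackAt G K Ψ q) {F : Pt → ℝ} (hF : ContDiffAt ℝ ∞ F (Ψ q))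
    (p r : Fin 3) :
    hess K (fun s => F (Ψ s)) p r q
      = ∑ a, ∑ b, jac Ψ q a p * jac Ψ q b r * hess G F a b (Ψ q) := by
  have e1 : ∑ m, gradUp K (fun s => F (Ψ s)) m q * chrLow K m p r q
      = ∑ c, gradUp G F c (Ψ q)
        * ((∑ a, ∑ b, jac Ψ q a p * jac Ψ q b r * chrLow G c a b (Ψ q))
        + ∑ a, G (Ψ q) c a * pd (fun s => jac Ψ s a r) p q) := by
    simp only [h.chrLow_eq, ← h.sum_jac_gradUp hF]
    generalize gradUp K (fun s => F (Ψ s)) = V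
    simp only [Fin.sum_univ_three]
    ring
  have e2 : ∀ a, pd F a (Ψ q) = ∑ c, gradUp G F c (Ψ q) * G (Ψ q) c a := by
    intro a
    rw [← h.target.lower_gradUp F a]
    exact Finset.sum_congr rfl fun c _ => by rw [h.target.symm_self a c, mul_comm]
  rw [h.source.hess_eq, h.pd_pd_comp hF, e1]
  simp only [h.target.hess_eq]
  simp only [e2, Fin.sum_univ_three, pd_comm hF 1 0, pd_comm hF 2 0, pd_comm hF 2 1]
  ring

theorem laplacian_eq (h : PullbackAt G K Ψ q) {F : Pt → ℝ} (hF : ContDiffAt ℝ ∞ F (Ψ q)) :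
    laplacian K (fun s => F (Ψ s)) q = laplacian G F (Ψ q) := by
  simp only [laplacian, h.hess_eq hF, ← h.sum_inv, Fin.sum_univ_three]
  ring

theorem gradDot_eq (h : PullbackAt G K Ψ q) {F H : Pt → ℝ} (hF : ContDiffAt ℝ ∞ F (Ψ q))
    (hH : ContDiffAt ℝ ∞ H (Ψ q)) :
    gradDot K (fun s => F (Ψ s)) (fun s => H (Ψ s)) q = gradDot G F H (Ψ q) := by
  simp only [gradDot, h.pd_comp hF, h.pd_comp hH, ← h.sum_inv, Fin.sum_univ_three]
  ring

end PullbackAt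

/-! ### The Laplacian in Brill form -/

/-- The metric `E (dρ² + dz²) + R (dφ + A dρ + B dz)²` in the coordinates `(ρ, φ, z)`. -/
noncomputable def conformalForm (E R A B : Pt → ℝ) (s : Pt) : Matrix (Fin 3) (Fin 3) ℝ :=
  !![E s + R s * A s * A s, R s * A s, R s * A s * B s;
    R s * A s, R s, R s * B s;
    R s * A s * B s, R s * B s, E s + R s * B s * B s]

theorem conformalForm_inv {E R A B : Pt → ℝ} {q : Pt} (hE : E q ≠ 0) (hR : R q ≠ 0) :
    (conformalForm E R A B q)⁻¹
      = !![1 / E q, -A q / E q, 0;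
          -A q / E q, 1 / R q + (A q ^ 2 + B q ^ 2) / E q, -B q / E q;
          0, -B q / E q, 1 / E q] := by
  apply Matrix.inv_eq_right_inv
  ext i j
  fin_cases i <;> fin_cases j <;>
    simp [conformalForm, Matrix.mul_apply, Fin.sum_univ_three] <;> field_simp <;> ring

theorem metricAt_conformalForm {E R A B : Pt → ℝ} {q : Pt}
    (sE : ContDiffAt ℝ ∞ E q) (sR : ContDiffAt ℝ ∞ R q) (sA : ContDiffAt ℝ ∞ A q)
    (sB : ContDiffAt ℝ ∞ B q) (hE : E q ≠ 0) (hR : R q ≠ 0) :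
    MetricAt (conformalForm E R A B) q where
  smooth i j := by
    fin_cases i <;> fin_cases j <;> simp [conformalForm] <;> fun_prop
  symm := Eventually.of_forall fun s i j => by
    fin_cases i <;> fin_cases j <;> simp [conformalForm]
  det_ne := by
    have : (conformalForm E R A B q).det = E q ^ 2 * R q := by
      simp [conformalForm, Matrix.det_fin_three]; ring
    rw [this]
    positivity

/-- For functions of `(ρ, z)`, the gradient of such a metric is conformal to the flat one. -/
theorem gradDot_conformalForm {E R A B : Pt → ℝ} {q : Pt} (hE : E q ≠ 0) (hR : R q ≠ 0)
    {c F : Pt → ℝ} (hc : pd c 1 q = 0) (hF : pd F 1 q = 0) :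
    gradDot (conformalForm E R A B) c F q
      = 1 / E q * (pd c 0 q * pd F 0 q + pd c 2 q * pd F 2 q) := by
  simp [gradDot, conformalForm_inv hE hR, Fin.sum_univ_three, hc, hF]
  ring

/-- The Laplacian of a function of `(ρ, z)`: as `√det = E √R`, it is
`E⁻¹ R^{-1/2} ∑ ∂_p (R^{1/2} ∂_p F)`. -/
theorem laplacian_conformalForm {E R A B : Pt → ℝ} {q : Pt}
    (sE : ContDiffAt ℝ ∞ E q) (sR : ContDiffAt ℝ ∞ R q) (sA : ContDiffAt ℝ ∞ A q)
    (sB : ContDiffAt ℝ ∞ B q) (hE : E q ≠ 0) (hR : R q ≠ 0)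
    (dE : pd E 1 q = 0) (dR : pd R 1 q = 0) (dA : pd A 1 q = 0) (dB : pd B 1 q = 0)
    {F : Pt → ℝ} (hF : ContDiffAt ℝ ∞ F q) (dF : ∀ᶠ s in 𝓝 q, pd F 1 s = 0) :
    laplacian (conformalForm E R A B) F q
      = 1 / E q * (pd (pd F 0) 0 q + pd (pd F 2) 2 q
          + (pd R 0 q * pd F 0 q + pd R 2 q * pd F 2 q) / (2 * R q)) := by
  have hK := metricAt_conformalForm sE sR sA sB hE hR
  have d1 : pd F 1 q = 0 := dF.self_of_nhds
  have dd : ∀ i, pd (pd F 1) i q = 0 := fun i => by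
    rw [pd_congr (H := fun _ => 0) dF, pd_const]
  have dd' : ∀ i, pd (pd F i) 1 q = 0 := fun i => by rw [pd_comm hF, dd]
  have m1 : ∀ {P Q : Pt → ℝ}, ContDiffAt ℝ ∞ P q → ContDiffAt ℝ ∞ Q q → ∀ k,
      pd (fun s => R s * P s * Q s) k q
        = R q * P q * pd Q k q + Q q * (R q * pd P k q + P q * pd R k q) := by
    intro P Q hP hQ k
    rw [pd_mul (sR.mul hP) hQ, pd_mul sR hP]
  have e00 : ∀ k, pd (fun s => conformalForm E R A B s 0 0) k q
      = pd E k q + (R q * A q * pd A k q + A q * (R q * pd A k q + A q * pd R k q)) := by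
    intro k
    rw [← m1 sA sA, ← pd_add sE ((sR.mul sA).mul sA)]; rfl
  have e22 : ∀ k, pd (fun s => conformalForm E R A B s 2 2) k q
      = pd E k q + (R q * B q * pd B k q + B q * (R q * pd B k q + B q * pd R k q)) := by
    intro k
    rw [← m1 sB sB, ← pd_add sE ((sR.mul sB).mul sB)]; rfl
  have e02 : ∀ k, pd (fun s => conformalForm E R A B s 0 2) k q
      = R q * A q * pd B k q + B q * (R q * pd A k q + A q * pd R k q) := by
    intro k
    rw [← m1 sA sB]; rfl
  have e01 : ∀ k, pd (fun s => conformalForm E R A B s 0 1) k q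
      = R q * pd A k q + A q * pd R k q := by
    intro k
    rw [← pd_mul sR sA]; rfl
  have e12 : ∀ k, pd (fun s => conformalForm E R A B s 1 2) k q
      = R q * pd B k q + B q * pd R k q := by
    intro k
    rw [← pd_mul sR sB]; rfl
  have e11 : ∀ k, pd (fun s => conformalForm E R A B s 1 1) k q = pd R k q := fun k => rfl
  have v0 : gradUp (conformalForm E R A B) F 0 q = pd F 0 q / E q := by
    simp [gradUp, conformalForm_inv hE hR, Fin.sum_univ_three, d1]; ring
  have v2 : gradUp (conformalForm E R A B) F 2 q = pd F 2 q / E q := by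
    simp [gradUp, conformalForm_inv hE hR, Fin.sum_univ_three, d1]; ring
  have v1 : gradUp (conformalForm E R A B) F 1 q
      = -(A q * pd F 0 q + B q * pd F 2 q) / E q := by
    simp [gradUp, conformalForm_inv hE hR, Fin.sum_univ_three, d1]; ring
  have i00 : (conformalForm E R A B q)⁻¹ 0 0 = 1 / E q := by simp [conformalForm_inv hE hR]
  have i01 : (conformalForm E R A B q)⁻¹ 0 1 = -A q / E q := by simp [conformalForm_inv hE hR]
  have i02 : (conformalForm E R A B q)⁻¹ 0 2 = 0 := by simp [conformalForm_inv hE hR]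
  have i11 : (conformalForm E R A B q)⁻¹ 1 1 = 1 / R q + (A q ^ 2 + B q ^ 2) / E q := by
    simp [conformalForm_inv hE hR]
  have i12 : (conformalForm E R A B q)⁻¹ 1 2 = -B q / E q := by simp [conformalForm_inv hE hR]
  have i22 : (conformalForm E R A B q)⁻¹ 2 2 = 1 / E q := by simp [conformalForm_inv hE hR]
  simp only [laplacian, hK.hess_eq, Fin.sum_univ_three, hK.inv_symm 1 0, hK.inv_symm 2 0,
    hK.inv_symm 2 1, i00, i01, i02, i11, i12, i22, v0, v1, v2, chrLow, hK.pd_symm 1 0,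
    hK.pd_symm 2 0, hK.pd_symm 2 1, e00, e01, e02, e11, e12, e22, dE, dR, dA, dB, dd, dd']
  field_simp
  ring

/-- A function of `(ρ, z)` has no derivative with respect to `φ`. -/
theorem pd_one_eq_zero {F : Pt → ℝ} {q : Pt} (hF : ContDiffAt ℝ ∞ F q)
    (h : ∀ s t : Pt, s 0 = t 0 → s 2 = t 2 → F s = F t) : pd F 1 q = 0 := by
  rw [pd, ← (hF.differentiableAt (by simp)).lineDeriv_eq_fderiv, lineDeriv]
  have : (fun t : ℝ => F (q + t • Pi.single 1 1)) = fun _ => F q := by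
    funext t
    apply h <;> simp
  rw [this, deriv_const]

/-- The product rule behind the Brill form: `∑ ∂_p (2 c √R ∂_p F)` divided by `2 E √R` is
`c ΔF + ∇c · ∇F` for a metric `E (dρ² + dz²) + R (dφ + …)²`. -/
theorem brill_expression {c F R k : Pt → ℝ} {q : Pt} {E : ℝ} (hc : ContDiffAt ℝ ∞ c q)
    (hF : ContDiffAt ℝ ∞ F q) (hR : ContDiffAt ℝ ∞ R q) (hR0 : 0 < R q)
    (hk : ∀ᶠ s in 𝓝 q, k s = 2 * c s * Real.sqrt (R s)) :
    1 / E / (2 * Real.sqrt (R q)) *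
      ∑ p ∈ ({0, 2} : Finset (Fin 3)), pd (fun s => k s * pd F p s) p q
      = c q * (1 / E * (pd (pd F 0) 0 q + pd (pd F 2) 2 q
          + (pd R 0 q * pd F 0 q + pd R 2 q * pd F 2 q) / (2 * R q)))
        + 1 / E * (pd c 0 q * pd F 0 q + pd c 2 q * pd F 2 q) := by
  have hs : ContDiffAt ℝ ∞ (fun s => Real.sqrt (R s)) q := hR.sqrt hR0.ne'
  have hsp : 0 < Real.sqrt (R q) := Real.sqrt_pos.2 hR0
  have hsq : R q = Real.sqrt (R q) ^ 2 := (Real.sq_sqrt hR0.le).symm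
  have ds : ∀ p, pd R p q = 2 * Real.sqrt (R q) * pd (fun s => Real.sqrt (R s)) p q := by
    intro p
    have e : R =ᶠ[𝓝 q] fun s => Real.sqrt (R s) * Real.sqrt (R s) := by
      filter_upwards [hR.continuousAt.eventually (lt_mem_nhds hR0)] with s hs
      exact (Real.mul_self_sqrt (le_of_lt hs)).symm
    rw [pd_congr e, pd_mul hs hs]; ring
  have h2c : ContDiffAt ℝ ∞ (fun s => 2 * c s) q := contDiffAt_const.mul hc
  have d : ∀ p, pd (fun s => k s * pd F p s) p q
      = 2 * c q * Real.sqrt (R q) * pd (pd F p) p q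
        + pd F p q * (2 * c q * pd (fun s => Real.sqrt (R s)) p q
          + Real.sqrt (R q) * (2 * pd c p q)) := by
    intro p
    rw [pd_congr (H := fun s => 2 * c s * Real.sqrt (R s) * pd F p s)
      (hk.mono fun s h => by simp only [h]), pd_mul (h2c.mul hs) (contDiffAt_pd hF p),
      pd_mul h2c hs, pd_mul contDiffAt_const hc, pd_const]
    ring
  rw [Finset.sum_pair (by decide), d, d, ds, ds]
  generalize Real.sqrt (R q) = t at *
  rw [hsq]
  by_cases hE : E = 0
  · simp [hE]
  field_simp
  ring

/-! ### Identification of the deformed metric -/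

section

variable {g G K : Pt → Matrix (Fin 3) (Fin 3) ℝ} {u f a φ : Pt → ℝ} {x : Pt}

theorem laplacian_congr (h : G =ᶠ[𝓝 x] K) (F : Pt → ℝ) : laplacian G F x = laplacian K F x := by
  have e : ∀ i j k, pd (fun y => G y i j) k x = pd (fun y => K y i j) k x := fun i j k =>
    pd_congr (h.mono fun y hy => by simp only [hy]) k
  simp only [laplacian, hess, christoffel, e, h.self_of_nhds]

theorem gradDot_congr (h : G x = K x) (F H : Pt → ℝ) : gradDot G F H x = gradDot K F H x := by
  simp only [gradDot, h]

theorem KillingAt.congr (hK : KillingAt K x) (h : G =ᶠ[𝓝 x] K) : KillingAt G x where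
  smooth i j := (hK.smooth i j).congr_of_eventuallyEq (h.mono fun y hy => by simp only [hy])
  symm := by
    filter_upwards [h, hK.symm] with y h1 h2
    rw [h1]; exact h2
  det_ne := by rw [h.self_of_nhds]; exact hK.det_ne
  lie i j := by
    have e : ∀ i j k, pd (fun y => G y i j) k x = pd (fun y => K y i j) k x := fun i j k =>
      pd_congr (h.mono fun y hy => by simp only [hy]) k
    rw [← hK.lie i j]
    simp only [lieTensor, e, h.self_of_nhds]

/-- The Lie derivative of `η♭` along `η` vanishes. -/
theorem KillingAt.lie_compPhi (h : KillingAt g x) (i : Fin 3) :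
    ∑ l, (rot x l * pd (compPhi g i) l x + compPhi g l x * pd (fun y => rot y l) i x) = 0 := by
  have e := h.sum_rot_covEta i
  rw [h.pd_phiPhi] at e
  simp only [covEta, Fin.sum_univ_three] at e ⊢
  linear_combination 2 * e

theorem DataAt.killingAt_deformed (h : DataAt g u f a x) : KillingAt (deformed g u f a) x where
  toMetricAt := h.metricAt_deformed
  lie i j := by
    have hf : ∀ i, ∑ l, (rot x l * pd (pd f i) l x + pd f l x * pd (fun y => rot y l) i x) = 0 := by
      intro i
      have := h.f_inv.sum_rot_pd i
      simp only [pd_comm h.f_inv.smooth _ i, Fin.sum_univ_three] at this ⊢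
      linear_combination this
    have hψ : ∑ l, rot x l * pd (fun y => u y ^ 2 + a y ^ 2 * phiPhi g y) l x = 0 := by
      have e1 := h.u_inv.sum_rot
      have e2 := h.a_inv.sum_rot
      have e3 := DataAt.phiPhi_rot h.killing
      have e : ∀ l, pd (fun y => u y ^ 2 + a y ^ 2 * phiPhi g y) l x = _ := h.pd_psi
      simp only [e, Fin.sum_univ_three] at *
      linear_combination 2 * u x * e1 + 2 * a x * phiPhi g x * e2 + a x ^ 2 * e3
    have ha := h.a_inv.sum_rot
    have hfi := hf i
    have hfj := hf j
    have hLi := h.killing.lie_compPhi i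
    have hLj := h.killing.lie_compPhi j
    have hg := h.killing.lie i j
    simp only [lieTensor, h.pd_deformed] at hg ⊢
    simp only [deformed, Matrix.of_apply, Fin.sum_univ_three] at *
    linear_combination hg + (pd f i x * compPhi g j x + compPhi g i x * pd f j x) * ha
      + a x * (compPhi g j x * hfi + pd f i x * hLj + pd f j x * hLi + compPhi g i x * hfj)
      + pd f i x * pd f j x * hψ
      + (u x ^ 2 + a x ^ 2 * phiPhi g x) * (pd f j x * hfi + pd f i x * hfj)

theorem compPhi_deformed (hf : lieFun rot f x = 0) (i : Fin 3) :
    compPhi (deformed g u f a) i x = compPhi g i x + a x * phiPhi g x * pd f i x := by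
  have e := MetricAt.phiPhi_eq g x
  simp only [lieFun] at hf
  rw [compPhi, compPhi.eq_1 g i]
  simp only [deformed, Matrix.of_apply, Fin.sum_univ_three] at *
  linear_combination (a x * compPhi g i x + (u x ^ 2 + a x ^ 2 * phiPhi g x) * pd f i x) * hf
    - a x * pd f i x * e

theorem phiPhi_deformed (hf : lieFun rot f x = 0) :
    phiPhi (deformed g u f a) x = phiPhi g x := by
  rw [MetricAt.phiPhi_eq, MetricAt.phiPhi_eq g]
  simp only [compPhi_deformed hf, lieFun, Fin.sum_univ_three] at *
  linear_combination a x * phiPhi g x * hf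

theorem invariantAt_const (c : ℝ) (x : Pt) : InvariantAt (fun _ => c) x where
  smooth := contDiffAt_const
  inv := Eventually.of_forall fun y => by simp [lieFun, pd_const]

theorem phiPhi_pos (hg : (g x).PosDef) (hx : x ∉ axis) : 0 < phiPhi g x := by
  have hr : rot x ≠ 0 := by
    intro h
    apply hx
    have h0 := congrFun h 0
    have h1 := congrFun h 1
    simp [rot] at h0 h1
    exact ⟨h1, h0⟩
  have := hg.dotProduct_mulVec_pos hr
  simp only [dotProduct, Matrix.mulVec, Pi.star_apply, star_trivial] at this
  refine this.trans_eq ?_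
  simp only [phiPhi, Fin.sum_univ_three]; ring

theorem phiPhi_nonneg (hg : (g x).PosDef) : 0 ≤ phiPhi g x := by
  have := hg.posSemidef.dotProduct_mulVec_nonneg (rot x)
  simp only [dotProduct, Matrix.mulVec, Pi.star_apply, star_trivial] at this
  refine this.trans_eq ?_
  simp only [phiPhi, Fin.sum_univ_three]; ring

theorem wFac_pos (hg : (g x).PosDef) (u f : Pt → ℝ) : 0 < wFac g u f x := by
  have h1 : 0 ≤ gradDot g f f x := by
    have := hg.inv.posSemidef.dotProduct_mulVec_nonneg fun i => pd f i x
    simp only [dotProduct, Matrix.mulVec, Pi.star_apply, star_trivial] at this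
    refine this.trans_eq ?_
    simp only [gradDot, Fin.sum_univ_three]; ring
  rw [wFac]; positivity

variable {Y : Pt → Fin 3 → ℝ}

/-- `Y = a η♭ + a² |η|² df`. As `ḡ` contains `Y`, this solves the duality relation for `Y`, by way of
`Y(η) = a |η|²`. -/
theorem form_eq (hf : lieFun rot f x = 0)
    (hY : ∀ i, Y x i = ∑ j, gBar g f Y φ x i j * (a x * rot x j)) (i : Fin 3) :
    Y x i = a x * compPhi g i x + a x ^ 2 * phiPhi g x * pd f i x := by
  have e : ∀ i, Y x i = a x * compPhi g i x + a x * (∑ j, Y x j * rot x j) * pd f i x := by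
    intro i
    rw [hY i, compPhi]
    simp only [lieFun] at hf
    simp only [gBar, Matrix.of_apply, Fin.sum_univ_three] at *
    linear_combination (a x * Y x i + a x * φ x * pd f i x) * hf
  have e2 : ∑ j, Y x j * rot x j = a x * phiPhi g x := by
    have := MetricAt.phiPhi_eq g x
    have e0 := e 0
    have e1 := e 1
    have e2 := e 2
    simp only [lieFun] at hf
    generalize ht : ∑ j, Y x j * rot x j = t at *
    simp only [Fin.sum_univ_three] at *
    linear_combination -ht + rot x 0 * e0 + rot x 1 * e1 + rot x 2 * e2 + a x * t * hf
      - a x * this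
  rw [e i, e2]; ring

theorem gBar_apply (hf : lieFun rot f x = 0)
    (hY : ∀ i, Y x i = ∑ j, gBar g f Y φ x i j * (a x * rot x j)) :
    gBar g f Y φ x = Matrix.of fun i j =>
      g x i j + a x * (pd f i x * compPhi g j x + compPhi g i x * pd f j x)
      + (φ x + 2 * a x ^ 2 * phiPhi g x) * (pd f i x * pd f j x) := by
  ext i j
  simp only [gBar, Matrix.of_apply, form_eq hf hY]
  ring

/-- `|Y|²_ḡ = a² |η|²` when `ḡ` is nondegenerate. -/
theorem formSq_eq (hf : lieFun rot f x = 0)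
    (hY : ∀ i, Y x i = ∑ j, gBar g f Y φ x i j * (a x * rot x j))
    (hdet : (gBar g f Y φ x).det ≠ 0) :
    formSq (gBar g f Y φ) Y x = a x ^ 2 * phiPhi g x := by
  have hv : Y x = (gBar g f Y φ x).mulVec fun j => a x * rot x j := funext hY
  have h1 : (gBar g f Y φ x)⁻¹.mulVec (Y x) = fun j => a x * rot x j := by
    conv_lhs => rw [hv]
    rw [Matrix.mulVec_mulVec, Matrix.nonsing_inv_mul _ (isUnit_iff_ne_zero.2 hdet),
      Matrix.one_mulVec]
  have h2 : formSq (gBar g f Y φ) Y x = ∑ i, Y x i * ((gBar g f Y φ x)⁻¹.mulVec (Y x)) i := by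
    simp only [formSq, Matrix.mulVec, dotProduct, Fin.sum_univ_three]; ring
  have e := MetricAt.phiPhi_eq g x
  rw [h2, h1]
  simp only [form_eq hf hY, lieFun, Fin.sum_univ_three] at *
  linear_combination -a x ^ 2 * e + a x ^ 3 * phiPhi g x * hf

/-- `ḡ` is the deformed metric; in particular it is nondegenerate, which is not presupposed. -/
theorem gBar_eq_deformed (hg : KillingAt g x) (hpos : (g x).PosDef) (hf : InvariantAt f x)
    (hY : ∀ i, Y x i = ∑ j, gBar g f Y φ x i j * (a x * rot x j)) (hu0 : 0 < u x)
    (hu : u x ^ 2 = φ x + formSq (gBar g f Y φ) Y x) :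
    φ x = u x ^ 2 - a x ^ 2 * phiPhi g x ∧ gBar g f Y φ x = deformed g u f a x := by
  have hf0 : lieFun rot f x = 0 := hf.inv.self_of_nhds
  have hdet : (gBar g f Y φ x).det ≠ 0 := by
    -- If `ḡ` were degenerate at `x`, its matrix inverse would be the junk value `0`, whence
    -- `φ = u²`, and `ḡ` would be a deformed metric with `u² + a² |η|² > 0` in place of `u²`.
    intro h0
    have hinv : (gBar g f Y φ x)⁻¹ = 0 := Matrix.nonsing_inv_apply_not_isUnit _ (by simp [h0])
    have hs : u x ^ 2 = φ x := by
      rw [hu, formSq, hinv]; simp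
    have hp : 0 < u x ^ 2 + a x ^ 2 * phiPhi g x := by
      have := phiPhi_nonneg hpos
      positivity
    have hd : DataAt g (fun _ => Real.sqrt (u x ^ 2 + a x ^ 2 * phiPhi g x)) f (fun _ => a x) x :=
      ⟨hg, invariantAt_const _ x, hf, invariantAt_const _ x, (Real.sqrt_pos.2 hp).ne',
        wFac_pos hpos _ _⟩
    apply hd.metricAt_deformed.det_ne
    rw [← h0, gBar_apply hf0 hY]
    congr 1
    ext i j
    simp only [deformed, Matrix.of_apply, Real.sq_sqrt hp.le, ← hs]
    ring
  have hφ : φ x = u x ^ 2 - a x ^ 2 * phiPhi g x := by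
    rw [hu, formSq_eq hf0 hY hdet]; ring
  refine ⟨hφ, ?_⟩
  rw [gBar_apply hf0 hY, hφ]
  ext i j
  simp only [deformed, Matrix.of_apply]
  ring

/-- If `Y = a η♭ + a² |η|² df` is invariant, then so is `a` where `η ≠ 0`. -/
theorem lieFun_eq_zero_of_form (hg : KillingAt g x) (hh : phiPhi g x ≠ 0) (hf : InvariantAt f x)
    (ha : ContDiffAt ℝ ∞ a x)
    (hY : ∀ᶠ y in 𝓝 x, ∀ i, Y y i = a y * compPhi g i y + a y ^ 2 * phiPhi g y * pd f i y)
    (hYi : ∀ i, lieForm rot Y i x = 0) : lieFun rot a x = 0 := by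
  have sL := hg.contDiffAt_compPhi
  have sh := hg.contDiffAt_phiPhi
  have sF := fun i => contDiffAt_pd hf.smooth i
  have sY : ∀ i, ContDiffAt ℝ ∞ (fun y => Y y i) x := fun i =>
    ((ha.mul (sL i)).add (((ha.pow 2).mul sh).mul (sF i))).congr_of_eventuallyEq
      (hY.mono fun y hy => hy i)
  have e : (fun y => ∑ i, Y y i * rot y i) =ᶠ[𝓝 x] fun y => a y * phiPhi g y := by
    filter_upwards [hY, hf.inv] with y h1 h2
    simp only [h1, MetricAt.phiPhi_eq g y, lieFun, Fin.sum_univ_three] at *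
    linear_combination a y ^ 2 * (compPhi g 0 y * rot y 0 + compPhi g 1 y * rot y 1
      + compPhi g 2 y * rot y 2) * h2
  have d : ∀ k, ∑ i, (Y x i * pd (fun y => rot y i) k x + rot x i * pd (fun y => Y y i) k x)
      = a x * pd (phiPhi g) k x + phiPhi g x * pd a k x := by
    intro k
    rw [← pd_mul ha sh, ← pd_congr e,
      pd_sum fun i => (sY i).mul (contDiff_rot i).contDiffAt]
    exact Finset.sum_congr rfl fun i _ => (pd_mul (sY i) (contDiff_rot i).contDiffAt k).symm
  have d0 := d 0
  have d1 := d 1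
  have d2 := d 2
  have y0 := hYi 0
  have y1 := hYi 1
  have y2 := hYi 2
  have hi := hg.phiPhi_inv
  refine mul_left_cancel₀ hh ?_
  simp only [lieForm, lieFun, Fin.sum_univ_three] at *
  linear_combination -rot x 0 * d0 - rot x 1 * d1 - rot x 2 * d2 + rot x 0 * y0 + rot x 1 * y1
    + rot x 2 * y2 - a x * hi

/-- If `φ = u² - a² |η|²` is invariant, then so is `u` where it does not vanish. -/
theorem lieFun_eq_zero_of_sq (hg : KillingAt g x) (ha : InvariantAt a x)
    (hu : ContDiffAt ℝ ∞ u x) (hu0 : u x ≠ 0)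
    (hφ : ∀ᶠ y in 𝓝 x, φ y = u y ^ 2 - a y ^ 2 * phiPhi g y) (hφi : lieFun rot φ x = 0) :
    lieFun rot u x = 0 := by
  have sh := hg.contDiffAt_phiPhi
  have sa := ha.smooth
  have e : (fun y => u y * u y) =ᶠ[𝓝 x] fun y => φ y + a y * a y * phiPhi g y :=
    hφ.mono fun y hy => by simp only [hy]; ring
  have sφ : ContDiffAt ℝ ∞ φ x :=
    ((hu.pow 2).sub ((sa.pow 2).mul sh)).congr_of_eventuallyEq hφ
  have d : ∀ k, 2 * u x * pd u k x = pd φ k x + 2 * a x * phiPhi g x * pd a k x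
      + a x ^ 2 * pd (phiPhi g) k x := by
    intro k
    have := pd_congr e k
    rw [pd_mul hu hu, pd_add sφ ((sa.mul sa).mul sh), pd_mul (sa.mul sa) sh, pd_mul sa sa] at this
    linear_combination this
  have e1 := ha.sum_rot
  have e2 := hg.phiPhi_inv
  have d0 := d 0
  have d1 := d 1
  have d2 := d 2
  refine mul_left_cancel₀ (mul_ne_zero two_ne_zero hu0) ?_
  simp only [lieFun, Fin.sum_univ_three] at *
  linear_combination rot x 0 * d0 + rot x 1 * d1 + rot x 2 * d2 + hφi
    + 2 * a x * phiPhi g x * e1 + a x ^ 2 * e2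

end

/-! ### Brill coordinates -/

theorem brillMatrix_eq (U α Aρ Az : ℝ → ℝ → ℝ) (q : Pt) :
    brillMatrix U α Aρ Az q
      = conformalForm (fun q => Real.exp (-2 * U (q 0) (q 2) + 2 * α (q 0) (q 2)))
        (fun q => q 0 ^ 2 * Real.exp (-2 * U (q 0) (q 2))) (fun q => Aρ (q 0) (q 2))
        (fun q => Az (q 0) (q 2)) q := by
  ext i j
  fin_cases i <;> fin_cases j <;> simp [brillMatrix, conformalForm]
  ring

theorem contDiffAt_of_coeff {V : ℝ → ℝ → ℝ}
    (hV : ContDiffOn ℝ ∞ (Function.uncurry V) {s | 0 < s.1}) {q : Pt} (hq : 0 < q 0) :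
    ContDiffAt ℝ ∞ (fun s : Pt => V (s 0) (s 2)) q := by
  have h1 : ContDiffAt ℝ ∞ (Function.uncurry V) (q 0, q 2) :=
    hV.contDiffAt ((isOpen_lt continuous_const continuous_fst).mem_nhds hq)
  have h2 : ContDiffAt ℝ ∞ (fun s : Pt => (s 0, s 2)) q := by fun_prop
  exact h1.comp q h2

/-- In Brill coordinates, `c Δa + ∇c · ∇a` with `c = |η|² / (2u)` is the expression of the
reduced equation. -/
theorem IsBrill.expression_eq {M : Set Pt}
    {g G : Pt → Matrix (Fin 3) (Fin 3) ℝ} {Ψ : Pt → Pt} {U α Aρ Az : ℝ → ℝ → ℝ}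
    (hB : IsBrill M G Ψ U α Aρ Az) (hG : ∀ y ∈ M, MetricAt G y)
    (hφ : ∀ y ∈ M, phiPhi G y = phiPhi g y) (hg : ∀ y ∈ M, ContDiffAt ℝ ∞ (phiPhi g) y)
    (hgi : ∀ y ∈ M, lieFun rot (phiPhi g) y = 0) {u a : Pt → ℝ}
    (hu : ∀ y ∈ M, InvariantAt u y) (hu0 : ∀ y ∈ M, 0 < u y)
    (ha : ∀ y ∈ M, InvariantAt a y) {q : Pt} (hq : 0 < q 0) :
    Real.exp (2 * U (q 0) (q 2) - 2 * α (q 0) (q 2)) / (2 * Real.sqrt (phiPhi g (Ψ q))) *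
      ∑ p ∈ ({0, 2} : Finset (Fin 3)),
        pd (fun s => (u (Ψ s))⁻¹ * phiPhi g (Ψ s) ^ (3 / 2 : ℝ)
          * pd (fun t => a (Ψ t)) p s) p q
      = (phiPhi g (Ψ q) * (1 / (2 * u (Ψ q)))) * laplacian G a (Ψ q)
        + gradDot G (fun y => phiPhi g y * (1 / (2 * u y))) a (Ψ q) := by
  have hopen : IsOpen {s : Pt | 0 < s 0} := isOpen_lt continuous_const (continuous_apply 0)
  have hnear : ∀ᶠ s in 𝓝 q, 0 < s 0 := hopen.mem_nhds hq
  have hmem : ∀ s : Pt, 0 < s 0 → Ψ s ∈ M := fun s hs =>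
    (hB.image ▸ Set.mem_image_of_mem Ψ hs : Ψ s ∈ M \ axis).1
  have hΨ : ∀ s : Pt, 0 < s 0 → ContDiffAt ℝ ∞ Ψ s := fun s hs =>
    hB.smooth.contDiffAt (hopen.mem_nhds hs)
  set E : Pt → ℝ := fun q => Real.exp (-2 * U (q 0) (q 2) + 2 * α (q 0) (q 2)) with hEdef
  set R : Pt → ℝ := fun q => q 0 ^ 2 * Real.exp (-2 * U (q 0) (q 2)) with hRdef
  set A : Pt → ℝ := fun q => Aρ (q 0) (q 2) with hAdef
  set B : Pt → ℝ := fun q => Az (q 0) (q 2) with hBdef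
  have sU := contDiffAt_of_coeff hB.smooth_U hq
  have sα := contDiffAt_of_coeff hB.smooth_α hq
  have sA : ContDiffAt ℝ ∞ A q := contDiffAt_of_coeff hB.smooth_Aρ hq
  have sB : ContDiffAt ℝ ∞ B q := contDiffAt_of_coeff hB.smooth_Az hq
  have sE : ContDiffAt ℝ ∞ E q :=
    ((contDiffAt_const.mul sU).add (contDiffAt_const.mul sα)).exp
  have sR : ContDiffAt ℝ ∞ R q :=
    ((contDiff_apply ℝ ℝ (0 : Fin 3)).contDiffAt.pow 2).mul (contDiffAt_const.mul sU).exp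
  have hE : E q ≠ 0 := (Real.exp_pos _).ne'
  have hR : 0 < R q := by positivity
  have dE : pd E 1 q = 0 := pd_one_eq_zero sE fun s t h0 h2 => by simp only [hEdef, h0, h2]
  have dR : pd R 1 q = 0 := pd_one_eq_zero sR fun s t h0 h2 => by simp only [hRdef, h0, h2]
  have dA : pd A 1 q = 0 := pd_one_eq_zero sA fun s t h0 h2 => by simp only [hAdef, h0, h2]
  have dB : pd B 1 q = 0 := pd_one_eq_zero sB fun s t h0 h2 => by simp only [hBdef, h0, h2]
  have hK : ∀ s : Pt, 0 < s 0 → ∀ p r,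
      conformalForm E R A B s p r = ∑ a, ∑ b, G (Ψ s) a b * (jac Ψ s a p * jac Ψ s b r) := by
    intro s hs p r
    rw [← brillMatrix_eq, ← hB.metric s hs]
    simp only [jac, Matrix.of_apply, mul_assoc]
  have hP : PullbackAt G (conformalForm E R A B) Ψ q :=
    ⟨hΨ q hq, metricAt_conformalForm sE sR sA sB hE hR.ne', hG _ (hmem q hq), hnear.mono hK⟩
  have hRphi : ∀ s : Pt, 0 < s 0 → R s = phiPhi g (Ψ s) := by
    intro s hs
    rw [← hφ _ (hmem s hs)]
    change conformalForm E R A B s 1 1 = _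
    rw [hK s hs]
    simp only [jac, Matrix.of_apply, hB.dphi s hs, phiPhi, mul_assoc]
  have hinv : ∀ {F : Pt → ℝ}, (∀ s : Pt, 0 < s 0 → ContDiffAt ℝ ∞ F (Ψ s)) →
      (∀ s : Pt, 0 < s 0 → lieFun rot F (Ψ s) = 0) →
      ∀ s : Pt, 0 < s 0 → pd (fun t => F (Ψ t)) 1 s = 0 := by
    intro F h1 h2 s hs
    rw [pd_comp ((h1 s hs).differentiableAt (by simp)) ((hΨ s hs).differentiableAt (by simp)),
      ← h2 s hs, lieFun]
    simp only [hB.dphi s hs, mul_comm]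
  have hFinv := hinv (fun s hs => (ha _ (hmem s hs)).smooth)
    fun s hs => (ha _ (hmem s hs)).inv.self_of_nhds
  have hx := hmem q hq
  have hF : ContDiffAt ℝ ∞ (fun t => a (Ψ t)) q := (ha _ hx).smooth.comp q (hΨ q hq)
  have hh0 : ∀ s : Pt, 0 < s 0 → phiPhi g (Ψ s) ≠ 0 := fun s hs => by
    rw [← hRphi s hs]; positivity
  have hcs : ∀ s : Pt, 0 < s 0 → ContDiffAt ℝ ∞ (fun y => phiPhi g y * (1 / (2 * u y))) (Ψ s) :=
    fun s hs => (hg _ (hmem s hs)).mul (contDiffAt_const.div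
      (contDiffAt_const.mul (hu _ (hmem s hs)).smooth) (by simpa using (hu0 _ (hmem s hs)).ne'))
  have hcinv := hinv hcs fun s hs => by
    have hy := hmem s hs
    have e1 := hgi _ hy
    have e2 := (hu _ hy).sum_rot
    simp only [lieFun, pd_weight (hu _ hy).smooth (hu0 _ hy).ne' (hg _ hy) (hh0 s hs),
      Fin.sum_univ_three] at *
    generalize phiPhi g (Ψ s) * (1 / (2 * u (Ψ s))) = c
    linear_combination c / phiPhi g (Ψ s) * e1 - c / u (Ψ s) * e2
  have hc : ContDiffAt ℝ ∞ (fun s => phiPhi g (Ψ s) * (1 / (2 * u (Ψ s)))) q :=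
    (hcs q hq).comp q (hΨ q hq)
  have hk : ∀ᶠ s in 𝓝 q, (u (Ψ s))⁻¹ * phiPhi g (Ψ s) ^ (3 / 2 : ℝ)
      = 2 * (phiPhi g (Ψ s) * (1 / (2 * u (Ψ s)))) * Real.sqrt (R s) := by
    filter_upwards [hnear] with s hs
    have hp : 0 < phiPhi g (Ψ s) := by rw [← hRphi s hs]; positivity
    have hu' := (hu0 _ (hmem s hs)).ne'
    rw [hRphi s hs, show (3 / 2 : ℝ) = 1 + 1 / 2 by norm_num, Real.rpow_add hp, Real.rpow_one,
      ← Real.sqrt_eq_rpow]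
    field_simp
  have hexp : Real.exp (2 * U (q 0) (q 2) - 2 * α (q 0) (q 2)) = 1 / E q := by
    simp only [hEdef]
    rw [one_div, ← Real.exp_neg]
    congr 1; ring
  rw [hexp, ← hRphi q hq, brill_expression hc hF sR hR hk,
    ← laplacian_conformalForm sE sR sA sB hE hR.ne' dE dR dA dB hF (hnear.mono hFinv),
    ← gradDot_conformalForm hE hR.ne' (hcinv q hq) (hFinv q hq),
    hP.laplacian_eq (ha _ hx).smooth,
    hP.gradDot_eq (F := fun y => phiPhi g y * (1 / (2 * u y))) (hcs q hq) (ha _ hx).smooth,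
    hRphi q hq]

end AxiData

/-! ### Equivalence of the four equations -/

open Filter Topology

theorem lemma4
    -- `M` is `ℝ³` minus finitely many points of the axis
    (P : Finset Pt) (hP : ∀ p ∈ P, p ∈ axis) (M : Set Pt) (hM : M = (P : Set Pt)ᶜ)
    -- a smooth axially symmetric Riemannian metric on `M`
    (g : Pt → Matrix (Fin 3) (Fin 3) ℝ)
    (hg_smooth : ∀ i j, ContDiffOn ℝ ∞ (fun x => g x i j) M)
    (hg_pos : ∀ x ∈ M, (g x).PosDef)
    (hg_killing : ∀ x ∈ M, ∀ i j, lieTensor rot g i j x = 0)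
    -- `f`, `φ`, `Y`, invariant under the symmetry
    (f φ : Pt → ℝ) (Y : Pt → Fin 3 → ℝ)
    (hf_smooth : ContDiffOn ℝ ∞ f M)
    (hf_inv : ∀ x ∈ M, lieFun rot f x = 0)
    (hφ_inv : ∀ x ∈ M, lieFun rot φ x = 0)
    (hY_inv : ∀ x ∈ M, ∀ i, lieForm rot Y i x = 0)
    -- the 1-form `Y` is dual with respect to `ḡ` to the vector field `Y^φ ∂_φ`
    (Yphi : Pt → ℝ) (hYphi_smooth : ContDiffOn ℝ ∞ Yphi M)
    (hY_dual : ∀ x ∈ M, ∀ i, Y x i = ∑ j, gBar g f Y φ x i j * (Yphi x * rot x j))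
    -- `u > 0` and `u² = φ + |Y|²_ḡ`
    (u : Pt → ℝ) (hu_smooth : ContDiffOn ℝ ∞ u M) (hu_pos : ∀ x ∈ M, 0 < u x)
    (hu : ∀ x ∈ M, u x ^ 2 = φ x + formSq (gBar g f Y φ) Y x)
    -- the equations are compared on an arbitrary part `Ω` of `M` (all of `M`, or a single point)
    (Ω : Set Pt) (hΩ : Ω ⊆ M) :
    (DivEq (gBar g f Y φ) Y u Ω ↔ LaplaceEq (gBar g f Y φ) g u Yphi Ω) ∧
    (∀ (Ψ : Pt → Pt) (U α Aρ Az : ℝ → ℝ → ℝ), IsBrill M (gBar g f Y φ) Ψ U α Aρ Az →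
      (LaplaceEq (gBar g f Y φ) g u Yphi Ω ↔ BrillEq g u Yphi Ψ U α Ω)) ∧
    (LaplaceEq (gBar g f Y φ) g u Yphi Ω ↔ EllipticEq g u f Yphi Ω) := by
  have hopen : IsOpen M := by
    rw [hM]; exact P.finite_toSet.isClosed.isOpen_compl
  have hnear : ∀ x ∈ M, ∀ᶠ y in 𝓝 x, y ∈ M := fun x hx => hopen.mem_nhds hx
  have hg : ∀ x ∈ M, KillingAt g x := fun x hx =>
    { smooth := fun i j => (hg_smooth i j).contDiffAt (hnear x hx)
      symm := (hnear x hx).mono fun y hy i j => by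
        simpa using (hg_pos y hy).isHermitian.apply j i
      det_ne := (hg_pos x hx).det_pos.ne'
      lie := hg_killing x hx }
  have hf : ∀ x ∈ M, InvariantAt f x := fun x hx =>
    ⟨hf_smooth.contDiffAt (hnear x hx), (hnear x hx).mono hf_inv⟩
  have hbar : ∀ x ∈ M, φ x = u x ^ 2 - Yphi x ^ 2 * phiPhi g x
      ∧ gBar g f Y φ x = deformed g u f Yphi x := fun x hx =>
    gBar_eq_deformed (hg x hx) (hg_pos x hx) (hf x hx) (hY_dual x hx) (hu_pos x hx) (hu x hx)
  have sa : ∀ x ∈ M, ContDiffAt ℝ ∞ Yphi x := fun x hx => hYphi_smooth.contDiffAt (hnear x hx)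
  have su : ∀ x ∈ M, ContDiffAt ℝ ∞ u x := fun x hx => hu_smooth.contDiffAt (hnear x hx)
  have sh : ∀ x ∈ M, ContDiffAt ℝ ∞ (phiPhi g) x := fun x hx => (hg x hx).contDiffAt_phiPhi
  have hha : ∀ x ∈ M, lieFun rot Yphi x = 0 := by
    intro x hx
    by_cases hax : x ∈ axis
    · simp [lieFun, rot, hax.1, hax.2, Fin.sum_univ_three]
    · refine lieFun_eq_zero_of_form (hg x hx) (phiPhi_pos (hg_pos x hx) hax).ne' (hf x hx)
        (sa x hx) ?_ (hY_inv x hx)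
      exact (hnear x hx).mono fun y hy => form_eq (hf_inv y hy) (hY_dual y hy)
  have ha : ∀ x ∈ M, InvariantAt Yphi x := fun x hx => ⟨sa x hx, (hnear x hx).mono hha⟩
  have hui : ∀ x ∈ M, InvariantAt u x := fun x hx =>
    ⟨su x hx, (hnear x hx).mono fun y hy => lieFun_eq_zero_of_sq (hg y hy) (ha y hy) (su y hy)
      (hu_pos y hy).ne' ((hnear y hy).mono fun z hz => (hbar z hz).1) (hφ_inv y hy)⟩
  have hd : ∀ x ∈ M, DataAt g u f Yphi x := fun x hx =>
    ⟨hg x hx, hui x hx, hf x hx, ha x hx, (hu_pos x hx).ne', wFac_pos (hg_pos x hx) u f⟩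
  have hgerm : ∀ x ∈ M, gBar g f Y φ =ᶠ[𝓝 x] deformed g u f Yphi := fun x hx =>
    (hnear x hx).mono fun y hy => (hbar y hy).2
  have hG : ∀ x ∈ M, KillingAt (gBar g f Y φ) x := fun x hx =>
    (hd x hx).killingAt_deformed.congr (hgerm x hx)
  have hφφ : ∀ x ∈ M, phiPhi (gBar g f Y φ) x = phiPhi g x := fun x hx => by
    rw [← phiPhi_deformed (g := g) (u := u) (a := Yphi) (hf_inv x hx), phiPhi, phiPhi, (hbar x hx).2]
  have hne : ∀ x ∈ M, x ∉ axis → phiPhi g x * (1 / (2 * u x)) ≠ 0 := fun x hx hax => by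
    have h1 := phiPhi_pos (hg_pos x hx) hax
    have h2 := hu_pos x hx
    positivity
  -- `c Δa + ∇c · ∇a`, with `c = |η|² / (2u)`, is a nonzero multiple of the second equation
  have hweight : ∀ x ∈ M, x ∉ axis →
      ((phiPhi g x * (1 / (2 * u x))) * laplacian (gBar g f Y φ) Yphi x
        + gradDot (gBar g f Y φ) (fun y => phiPhi g y * (1 / (2 * u y))) Yphi x = 0
      ↔ laplacian (gBar g f Y φ) Yphi x
        + gradDot (gBar g f Y φ) (fun y => Real.log ((u y)⁻¹ * phiPhi g y)) Yphi x = 0) := by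
    intro x hx hax
    rw [weighted_laplacian_eq (sh x hx) (phiPhi_pos (hg_pos x hx) hax).ne' (su x hx)
      (hu_pos x hx).ne', mul_eq_zero, or_iff_right (hne x hx hax)]
  refine ⟨?_, ?_, ?_⟩
  · have hdiv : ∀ x ∈ M, ∑ l, divTensor (gBar g f Y φ) (kBar (gBar g f Y φ) Y u) l x * rot x l
        = (phiPhi g x * (1 / (2 * u x))) * laplacian (gBar g f Y φ) Yphi x
        + gradDot (gBar g f Y φ) (fun y => phiPhi g y * (1 / (2 * u y))) Yphi x := by
      intro x hx
      rw [KillingAt.divTensor_kBar ((hnear x hx).mono hG) ((hnear x hx).mono ha)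
        ((hnear x hx).mono fun y hy i => ?_) (su x hx) (hu_pos x hx).ne', hφφ x hx]
      · have : (fun y => phiPhi (gBar g f Y φ) y * (1 / (2 * u y)))
            =ᶠ[𝓝 x] fun y => phiPhi g y * (1 / (2 * u y)) :=
          (hnear x hx).mono fun y hy => by simp only [hφφ y hy]
        simp only [gradDot, pd_congr this]
      · rw [hY_dual y hy i, compPhi, Finset.mul_sum]
        exact Finset.sum_congr rfl fun j _ => by ring
    constructor
    · intro h x hx
      have := h x hx.1
      rw [hdiv x (hΩ hx.1)] at this
      exact (hweight x (hΩ hx.1) hx.2).1 this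
    · intro h x hx
      by_cases hax : x ∈ axis
      · simp [rot, hax.1, hax.2, Fin.sum_univ_three]
      · rw [hdiv x (hΩ hx)]
        exact (hweight x (hΩ hx) hax).2 (h x ⟨hx, hax⟩)
  · intro Ψ U α Aρ Az hB
    have hexp := fun (q : Pt) (hq : 0 < q 0) => hB.expression_eq (fun y hy => (hG y hy).toMetricAt) hφφ sh
      (fun y hy => (hg y hy).phiPhi_inv) hui hu_pos ha hq
    have him : ∀ q : Pt, 0 < q 0 → Ψ q ∈ M \ axis := fun q hq =>
      hB.image ▸ Set.mem_image_of_mem Ψ hq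
    constructor
    · intro h q hq hqΩ
      rw [hexp q hq]
      exact (hweight _ (him q hq).1 (him q hq).2).2 (h _ ⟨hqΩ, (him q hq).2⟩)
    · intro h x hx
      obtain ⟨q, hq, rfl⟩ : x ∈ Ψ '' {q | 0 < q 0} := hB.image ▸ ⟨hΩ hx.1, hx.2⟩
      have := h q hq hx.1
      rw [hexp q hq] at this
      exact (hweight _ (hΩ hx.1) hx.2).1 this
  · refine forall₂_congr fun x hx => ?_
    have hxM := hΩ hx.1
    rw [laplacian_congr (hgerm x hxM), gradDot_congr (hgerm x hxM).self_of_nhds,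
      (hd x hxM).laplacian_add_eq_elliptic (phiPhi_pos (hg_pos x hxM) hx.2).ne']
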